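/- **Corollary (Weakly Correlated PGDML Deviation Over Time).** *Asymptotic notation.* Let $M_n$ ($n\in\mathbb N$) be random tensors, $\|\cdot\|$ the subordinate norm (the supremum of the contractions with unit vectors in all indices), and $f:\mathbb N\to[0,\infty)$. Write $M=O(f)$ if $P(\|M_n\|\le g(n))\to1$ as $n\to\infty$ for every $g:\mathbb N\to[0,\infty)$ with $f=o(g)$. For increasing functions $\mathcal K^i$, a family satisfies $M^{(i)}=O(\mathcal K^i\circ f)$ *uniformly in $i$* if $P(\forall i:\|M^{(i)}_n\|\le\mathcal K^i(g(n)))\to1$ for every such $g$. *Setting.* Let $\mathcal P$ be a probability distribution on an input set $X\subseteq\mathbb R^{d_X}$ and $\hat y:X\to\mathbb R^{d_Y}$ a measurable target. For each $n$ let $F(\theta)(x)\in\mathbb R^{d_Y}$, $\theta\in\mathbb R^{N(n)}$, be a hypothesis function that is real-analytic in $\theta$ and measurable in $x$, let $\theta_0$ be random initial parameters, and let $\eta=\eta(n)>0$. Let $\mathcal C(z,y)$ be a measurable cost, convex and real-analytic in $z\in\mathbb R^{d_Y}$, with gradient $\mathcal C'$ and Hessian $\mathcal C''$ in $z$. A test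 input $x$ and training inputs $x_0,x_1,\dots$ are drawn from $\mathcal P$, independently of each other and of $\theta_0$; all probabilities below refer to $(\theta_0,x,(x_s)_s)$. With $(\nabla F)_{\alpha i}=\partial_{\theta_\alpha}F_i$, single-input SGD is $\theta(0)=\theta_0$, $$\theta(s+1)=\theta(s)-\eta\,\nabla F(\theta(s))(x_s)\,\mathcal C'\big(F(\theta(s))(x_s),\hat y(x_s)\big),$$ and, with $\Theta_0(x,x')=\eta\,\nabla F(\theta_0)(x)^T\nabla F(\theta_0)(x')$, the linearisation is $F_{lin}(0)=F(\theta_0)$, $$F_{lin}(s+1)=F_{lin}(s)-\Theta_0(\cdot,x_s)\,\mathcal C'\big(F_{lin}(s)(x_s),\hat y(x_s)\big).$$ For $D\ge0$, $d\ge1$, the derivative correlations at $\theta_0$ are $$\mathfrak C^{D,d}(x,x'_1,\dots,x'_d)=\frac{\eta^{D/2+d}}{D!\,d!}\,\nabla^{\times(D+d)}F(\theta_0)(x)^T\big(\nabla F(\theta_0)(x'_1)\times\cdots\times\nabla F(\theta_0)(x'_d)\big).$$ *PGDML.* The system is a PGDML if (i) $F(\theta_0)(x)=O(1)$; (ii)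 $F(\theta(1))(x)-F(\theta_0)(x)=O(1)$; (iii) $O(\mathfrak C^{0,1})=\eta\,O(\nabla F(\theta_0))^2$, that is, for every $f\ge0$, $\mathfrak C^{0,1}(x,x_0)=O(\eta f^2)$ if and only if $\nabla F(\theta_0)(x)=O(f)$; (iv) $O(\nabla^{\times d}F(\theta_0))\le O(\nabla F(\theta_0))^d$ uniformly in $d\ge1$, that is, whenever $\nabla F(\theta_0)(x)=O(f)$, also $\nabla^{\times d}F(\theta_0)(x)=O(f^d)$ uniformly in $d$ (with $\mathcal K^d(r)=r^d$). *Weak correlations.* Let $m(n)\to\infty$. The system is exponentially $m(n)$-weakly correlated if $$\mathfrak C^{D,d}\big(x,x_0^{\times d_1},\dots,x_{k-1}^{\times d_k}\big)=O\Big(\tfrac1{\sqrt{m(n)}}\Big)^d$$ uniformly over all $D\ge0$, $d\ge1$ with $(D,d)\ne(0,1)$ and all $1\le d_1\le\dots\le d_k$ with $d_1+\dots+d_k=d$ (with $\mathcal K(r)=r^d$). *Critical learning rate.* Fix any constant $L>0$ (a curvature scale of the cost; $L=1$ for $\mathcal C(z,y)=\frac12\|z-y\|^2$), and put $\eta_{cor}=2/\big(L\,\lambda_{\max}(\nabla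 F(\theta_0)(x)^T\nabla F(\theta_0)(x))\big)$, read as $\infty$ if the denominator is $0$. The condition $\eta<\eta_{cor}$ means $P(\eta<\eta_{cor})\to1$. *Statement.* Take an exponentially $m(n)$-weakly correlated PGDML trained by single-input SGD with $\eta<\eta_{cor}$. Let $S\in\mathbb N$ and $T>0$ be independent of $n$, and suppose that, uniformly in $s=1,\dots,S$, $$\mathcal C'\big(F_{lin}(s)(x),\hat y(x)\big)=O\big(e^{-s/T}\big),\qquad \mathcal C''\big(F_{lin}(s)(x),\hat y(x)\big)=O(1).$$ Then, uniformly in $s=1,\dots,S$, $$F(\theta(s))(x)-F_{lin}(s)(x)=O\Big(\frac{s^0}{m(n)}\Big).$$ -/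

import Mathlib

open MeasureTheory Filter Asymptotics Topology
open scoped ENNReal Gradient

noncomputable section

/-! ## Stochastic big-O notation -/

/-- `M = O(f)` for a sequence of random tensors, given through the norms `M n ω`:
for every nonnegative `g` with `f = o(g)`, `P(‖M_n‖ ≤ g(n)) → 1`. The convergence is written for
the complementary event, `P(¬ ‖M_n‖ ≤ g(n)) → 0`, which is the same for measurable events. -/
def StochBigO {Ω : ℕ → Type*} [∀ n, MeasurableSpace (Ω n)] (P : ∀ n, Measure (Ω n))
    (M : ∀ n, Ω n → ℝ) (f : ℕ → ℝ) : Prop :=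
  ∀ g : ℕ → ℝ, (∀ n, 0 ≤ g n) → f =o[atTop] g →
    Tendsto (fun n => P n {ω | ¬ M n ω ≤ g n}) atTop (𝓝 0)

/-- `M^{(i)} = O(K^i ∘ f)` uniformly in `i : ι`, for a family of sequences of random tensors, given
through the norms `M n i ω`: for every nonnegative `g` with `f = o(g)`,
`P(∀ i, ‖M_n^{(i)}‖ ≤ K^i (g(n))) → 1`, again written for the complementary event. -/
def StochBigOUnif {Ω : ℕ → Type*} [∀ n, MeasurableSpace (Ω n)] (P : ∀ n, Measure (Ω n))
    {ι : Type*} (M : ∀ n, ι → Ω n → ℝ) (K : ι → ℝ → ℝ) (f : ℕ → ℝ) : Prop :=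
  ∀ g : ℕ → ℝ, (∀ n, 0 ≤ g n) → f =o[atTop] g →
    Tendsto (fun n => P n {ω | ¬ ∀ i, M n i ω ≤ K i (g n)}) atTop (𝓝 0)

/-! ## Gradient-descent learning systems -/

/-- `ℝᵏ` with the Euclidean norm. -/
abbrev Euc (k : ℕ) : Type := EuclideanSpace ℝ (Fin k)

/-- A gradient-descent machine-learning system with limiting parameter `n`, inputs in
`X ⊆ ℝ^{dX}` and outputs in `ℝ^{dY}`. -/
structure GDML (dX dY : ℕ) where
  /-- the input set -/
  X : Set (Euc dX)
  /-- the distribution of the inputs, the same for training and testing -/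
  inputLaw : Measure X
  inputLaw_prob : IsProbabilityMeasure inputLaw
  /-- the number of parameters -/
  N : ℕ → ℕ
  /-- the hypothesis function -/
  F : ∀ n, Euc (N n) → X → Euc dY
  F_measurable : ∀ n θ, Measurable (F n θ)
  F_analytic : ∀ n x, AnalyticOnNhd ℝ (fun θ => F n θ x) Set.univ
  /-- the distribution of the initial parameters -/
  initLaw : ∀ n, Measure (Euc (N n))
  initLaw_prob : ∀ n, IsProbabilityMeasure (initLaw n)
  /-- the target function -/
  target : X → Euc dY
  target_measurable : Measurable target
  /-- the cost `𝒞(prediction, label)` -/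
  cost : Euc dY → Euc dY → ℝ
  cost_measurable : Measurable (fun p : Euc dY × Euc dY => cost p.1 p.2)
  cost_analytic : ∀ y, AnalyticOnNhd ℝ (fun z => cost z y) Set.univ
  cost_convex : ∀ y, ConvexOn ℝ Set.univ (fun z => cost z y)
  /-- the learning rate -/
  η : ℕ → ℝ
  η_pos : ∀ n, 0 < η n

namespace GDML

variable {dX dY : ℕ} (G : GDML dX dY) (n : ℕ)

instance : IsProbabilityMeasure G.inputLaw := G.inputLaw_prob

instance : IsProbabilityMeasure (G.initLaw n) := G.initLaw_prob n

/-- `𝒞'(z, y)`: the gradient of the cost in the prediction `z`. -/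
def cost' (z y : Euc dY) : Euc dY := ∇ (fun z' => G.cost z' y) z

/-- `𝒞''(z, y)`: the Hessian matrix of the cost in the prediction `z`, as a linear map. -/
def cost'' (z y : Euc dY) : Euc dY →L[ℝ] Euc dY := fderiv ℝ (fun z' => G.cost' z' y) z

/-- The transposed Jacobian `∇F(θ)(x)ᵀ : v ↦ ∑_α (∇_α F(θ)(x)) v_α`. -/
def jac (θ : Euc (G.N n)) (x : G.X) : Euc (G.N n) →L[ℝ] Euc dY :=
  fderiv ℝ (fun θ' => G.F n θ' x) θ

/-- The Jacobian matrix `∇F(θ)(x) : u ↦ (∑_i (∇_α F_i(θ)(x)) u_i)_α`. -/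
def jacT (θ : Euc (G.N n)) (x : G.X) : Euc dY →L[ℝ] Euc (G.N n) :=
  ContinuousLinearMap.adjoint (G.jac n θ x)

/-- The kernel `Θ(θ)(x, x') = η ∇F(θ)(x)ᵀ ∇F(θ)(x')`. -/
def kernel (θ : Euc (G.N n)) (x x' : G.X) : Euc dY →L[ℝ] Euc dY :=
  G.η n • (G.jac n θ x ∘L G.jacT n θ x')

/-- `∇^{×k} F(θ)(x)`, a tensor with `k` parameter indices and one output index. Its operator norm
is its subordinate norm: the supremum of its contractions with unit vectors in all indices. -/
def deriv (k : ℕ) (θ : Euc (G.N n)) (x : G.X) :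
    ContinuousMultilinearMap ℝ (fun _ : Fin k => Euc (G.N n)) (Euc dY) :=
  iteratedFDeriv ℝ k (fun θ' => G.F n θ' x) θ

/-- The derivative correlation `ℭ^{D,d}(θ)(x₀, x₁ … x_d)`, a tensor with one output index for `x₀`,
one output index for each of `x₁ … x_d`, and `D` parameter indices:
`η^{D/2+d} / (D! d!) * ∇^{×(D+d)}F(θ)(x₀)ᵀ (∇F(θ)(x₁) × ⋯ × ∇F(θ)(x_d))`.
Its operator norm is its subordinate norm. -/
def correlation (D d : ℕ) (θ : Euc (G.N n)) (x₀ : G.X) (x : Fin d → G.X) :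
    ContinuousMultilinearMap ℝ (fun _ : Fin d => Euc dY)
      (ContinuousMultilinearMap ℝ (fun _ : Fin D => Euc (G.N n)) (Euc dY)) :=
  (G.η n ^ ((D : ℝ) / 2 + d) / (D.factorial * d.factorial : ℝ)) •
    (((G.deriv n (d + D) θ x₀).domDomCongr finSumFinEquiv.symm).currySum).compContinuousLinearMap
      (fun k => G.jacT n θ (x k))

/-- The correlation contracted with `u₁ … u_d` in its output indices and `v₁ … v_D` in its
parameter indices. -/
theorem correlation_apply (D d : ℕ) (θ : Euc (G.N n)) (x₀ : G.X) (x : Fin d → G.X)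
    (u : Fin d → Euc dY) (v : Fin D → Euc (G.N n)) :
    G.correlation n D d θ x₀ x u v =
      (G.η n ^ ((D : ℝ) / 2 + d) / (D.factorial * d.factorial : ℝ)) •
        iteratedFDeriv ℝ (d + D) (fun θ' => G.F n θ' x₀) θ
          (Fin.append (fun k => G.jacT n θ (x k) (u k)) v) := by
  simp only [correlation, deriv, smul_apply,
    ContinuousMultilinearMap.compContinuousLinearMap_apply,
    ContinuousMultilinearMap.currySum_apply, ContinuousMultilinearMap.domDomCongr_apply]
  congr 2
  funext i
  refine Fin.addCases (fun j => ?_) (fun j => ?_) i <;> simp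

/-- Single-input stochastic gradient descent along the path of inputs `xs`, started at `θ₀`:
`θ(s+1) = θ(s) - η ∇F(θ(s))(x_s) 𝒞'(F(θ(s))(x_s), ŷ(x_s))`. -/
def train (θ₀ : Euc (G.N n)) (xs : ℕ → G.X) : ℕ → Euc (G.N n)
  | 0 => θ₀
  | s + 1 => train θ₀ xs s - G.η n •
      G.jacT n (train θ₀ xs s) (xs s)
        (G.cost' (G.F n (train θ₀ xs s) (xs s)) (G.target (xs s)))

/-- The linearised hypothesis function: `F_lin(0) = F(θ₀)` and
`F_lin(s+1) = F_lin(s) - Θ₀(·, x_s) 𝒞'(F_lin(s)(x_s), ŷ(x_s))`. -/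
def Flin (θ₀ : Euc (G.N n)) (xs : ℕ → G.X) : ℕ → G.X → Euc dY
  | 0 => G.F n θ₀
  | s + 1 => fun x => Flin θ₀ xs s x -
      G.kernel n θ₀ x (xs s) (G.cost' (Flin θ₀ xs s (xs s)) (G.target (xs s)))

/-- A training step is a gradient step for `θ ↦ 𝒞(F(θ)(x_s), ŷ(x_s))`. -/
theorem train_succ_eq_gradient (θ₀ : Euc (G.N n)) (xs : ℕ → G.X) (s : ℕ) :
    G.train n θ₀ xs (s + 1) = G.train n θ₀ xs s - G.η n •
      ∇ (fun θ => G.cost (G.F n θ (xs s)) (G.target (xs s))) (G.train n θ₀ xs s) := by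
  have hF : DifferentiableAt ℝ (fun θ => G.F n θ (xs s)) (G.train n θ₀ xs s) :=
    (G.F_analytic n (xs s) _ (Set.mem_univ _)).differentiableAt
  have hC : DifferentiableAt ℝ (fun z => G.cost z (G.target (xs s)))
      (G.F n (G.train n θ₀ xs s) (xs s)) :=
    (G.cost_analytic (G.target (xs s)) _ (Set.mem_univ _)).differentiableAt
  have h := HasFDerivAt.comp (f := fun θ => G.F n θ (xs s)) (G.train n θ₀ xs s)
    hC.hasGradientAt.hasFDerivAt hF.hasFDerivAt
  rw [train]
  congr 2
  refine (HasGradientAt.gradient ?_).symm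
  rw [hasGradientAt_iff_hasFDerivAt]
  have e : InnerProductSpace.toDual ℝ (Euc (G.N n)) (G.jacT n (G.train n θ₀ xs s) (xs s)
        (G.cost' (G.F n (G.train n θ₀ xs s) (xs s)) (G.target (xs s)))) =
      (InnerProductSpace.toDual ℝ (Euc dY) (∇ (fun z => G.cost z (G.target (xs s)))
        (G.F n (G.train n θ₀ xs s) (xs s)))) ∘L
          fderiv ℝ (fun θ => G.F n θ (xs s)) (G.train n θ₀ xs s) := by
    ext v
    simp [jacT, jac, cost', ContinuousLinearMap.adjoint_inner_left]
  rw [e]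
  exact h

/-! ### The random quantities

A sample consists of the initial parameters, a test input, and the path of training inputs; all
inputs are drawn independently from the input distribution. -/

/-- The sample space: initial parameters `ω.1`, test input `ω.2.1`, training path `ω.2.2`. -/
abbrev Sample : Type := Euc (G.N n) × G.X × (ℕ → G.X)

/-- The law of a sample. -/
def law : Measure (G.Sample n) :=
  (G.initLaw n).prod (G.inputLaw.prod (Measure.infinitePi fun _ : ℕ => G.inputLaw))

/-- The index set of the weak-correlation condition: `(D, d) ≠ (0, 1)` with `d ≥ 1`, and
multiplicities `d₁ ≤ ⋯ ≤ d_k` with sum `d`. -/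
structure CorrIndex where
  D : ℕ
  d : ℕ
  d_pos : 1 ≤ d
  ne_kernel : (D, d) ≠ (0, 1)
  mult : Composition d
  mult_mono : Monotone mult.blocksFun

/-- Exponential (power) `m(n)`-weak derivative correlations: over all `(D, d) ≠ (0, 1)` and all
patterns of coinciding inputs, uniformly,
`ℭ^{D,d}(x₀, x₁^{×d₁}, …, x_k^{×d_k}) = O(1/√m(n))^d` at the initial parameters. -/
def ExpWeaklyCorrelated (m : ℕ → ℝ) : Prop :=
  StochBigOUnif G.law
    (fun n (i : CorrIndex) ω =>
      ‖G.correlation n i.D i.d ω.1 ω.2.1 (fun k => ω.2.2 (i.mult.index k))‖)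
    (fun i r => r ^ i.d) (fun n => 1 / √(m n))

/-- Proper normalisation. An asymptotic behaviour `O(M)` enters through the set of all
asymptotic upper bounds of `M`. -/
structure IsPGDML : Prop where
  /-- `F(θ₀) = O(1)` -/
  init_bounded : StochBigO G.law (fun n ω => ‖G.F n ω.1 ω.2.1‖) (fun _ => 1)
  /-- `F(θ(1)) - F(θ₀) = O(1)` -/
  step_bounded : StochBigO G.law
    (fun n ω => ‖G.F n (G.train n ω.1 ω.2.2 1) ω.2.1 - G.F n ω.1 ω.2.1‖) (fun _ => 1)
  /-- `O(ℭ¹) = η O(∇F(θ₀))²` -/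
  kernel_maximal : ∀ f : ℕ → ℝ, (∀ n, 0 ≤ f n) →
    (StochBigO G.law
        (fun n ω => ‖G.correlation n 0 1 ω.1 ω.2.1 (fun _ => ω.2.2 0)‖)
        (fun n => G.η n * f n ^ 2) ↔
      StochBigO G.law (fun n ω => ‖G.deriv n 1 ω.1 ω.2.1‖) f)
  /-- `O(∇^{×d}F(θ₀)) ≤ O(∇F(θ₀))^d` uniformly in `d ≥ 1` -/
  deriv_dominated : ∀ f : ℕ → ℝ, (∀ n, 0 ≤ f n) →
    StochBigO G.law (fun n ω => ‖G.deriv n 1 ω.1 ω.2.1‖) f →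
      StochBigOUnif G.law (fun n (d : {d : ℕ // 1 ≤ d}) ω => ‖G.deriv n d ω.1 ω.2.1‖)
        (fun d r => r ^ (d : ℕ)) f

/-- The critical learning rate `η_cor = 2 / (L λ_max(∇F(θ₀)(x)ᵀ ∇F(θ₀)(x)))` of the linearised
step on the input `x`, for a cost of curvature `L` (`L = 1` for `𝒞(z, y) = ‖z - y‖²/2`): below it
the step map `1 - L Θ₀(x, x)` on the error at `x` is non-expansive. It is `∞` if
`∇F(θ₀)(x) = 0`. -/
def criticalRate (L : ℝ) (θ₀ : Euc (G.N n)) (x : G.X) : ℝ≥0∞ :=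
  2 / ENNReal.ofReal (L * ‖G.jac n θ₀ x ∘L G.jacT n θ₀ x‖)

/-- `η < η_cor`, with probability tending to one. -/
def Subcritical (L : ℝ) : Prop :=
  Tendsto (fun n => G.law n
    {ω | ¬ ENNReal.ofReal (G.η n) < G.criticalRate n L ω.1 ω.2.1}) atTop (𝓝 0)

end GDML

end

/-! ### Taylor series with bounded words -/

section Taylor

variable {E V : Type*} [NormedAddCommGroup E] [NormedSpace ℝ E]
  [NormedAddCommGroup V] [NormedSpace ℝ V]

/-! Put κ = K/√m. Up to O(κ²), training sees only the linearisation, because each step uses a fresh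
input, nearly uncorrelated with the earlier ones. To quantify this, directions in parameter space
get weights: η∇F(θ₀)(x_r)u weighs κ‖u‖, and an arbitrary w weighs K‖w‖/√η. Weak correlations, the
derivative bounds of a PGDML and η < η_cor together say that a derivative of order k ≥ 2 of
F(·)(x_j) at θ₀, evaluated on a word, is at most k! times the product of the weights, provided x_j
contributes no gradient letter (`DerivBounds.wordBound`). The Taylor coefficient cancels k!, so
remainders are geometric series.

By induction on s (`Displacement.succ`), θ(s) − θ₀ is a sum of terms η∇F(θ₀)(x_r)u_r and a
correction b, of total weight O(κ). The correction comes from the movement of the gradient. That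
movement at a fresh input, tested on a direction, is O(κ) times the weight of the direction. Hence b
has norm O(√η κ), and pairs with gradients at unused inputs to O(κ²). The Taylor remainder is O(κ²)
too, so F(θ(s)) and F_lin(s) differ by O(κ²) at unused inputs, including the test input. The
Lipschitz bound of the cost gradient carries this to the next step, and κ² is of order 1/m.

For the probabilistic part, an O-statement becomes a bound with a constant factor outside an event
of small probability (`HighProb.of_forall_isLittleO`). Test and training inputs form one i.i.d.
sequence, so the bounds transfer to each of the finitely many arrangements of the first S + 1 inputs
(`measurePreserving_permute`). The cost gradient is controlled because the input law does not depend
on n. -/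

theorem AnalyticOnNhd.hasSum_iteratedFDeriv_of_norm_le [CompleteSpace V] {g : E → V}
    (hg : AnalyticOnNhd ℝ g Set.univ) (x : E) {C M : ℝ}
    (h : ∀ k, ‖iteratedFDeriv ℝ k g x‖ ≤ C * M ^ k) (y : E) :
    HasSum (fun k : ℕ => (k.factorial : ℝ)⁻¹ • iteratedFDeriv ℝ k g x fun _ => y) (g (x + y)) := by
  let p : FormalMultilinearSeries ℝ E V :=
    fun k => (k.factorial : ℝ)⁻¹ • iteratedFDeriv ℝ k g x
  have hr : p.radius = ∞ := by
    refine p.radius_eq_top_of_summable_norm fun r => ?_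
    refine Summable.of_nonneg_of_le (fun k => by positivity) (fun k => ?_)
      ((Real.summable_pow_div_factorial (M * r)).mul_left C)
    have : ‖p k‖ = (k.factorial : ℝ)⁻¹ * ‖iteratedFDeriv ℝ k g x‖ := by
      simp only [p, norm_smul, norm_inv, Real.norm_natCast]
    rw [this, mul_pow]
    calc (k.factorial : ℝ)⁻¹ * ‖iteratedFDeriv ℝ k g x‖ * (r : ℝ) ^ k
        ≤ (k.factorial : ℝ)⁻¹ * (C * M ^ k) * (r : ℝ) ^ k := by gcongr; exact h k
      _ = _ := by rw [div_eq_inv_mul]; ring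
  have hp : HasFPowerSeriesOnBall p.sum p 0 ∞ := hr ▸ p.hasFPowerSeriesOnBall (by simp [hr])
  have hpx : AnalyticOnNhd ℝ (fun z => p.sum (z - x)) Set.univ := by
    intro z _
    have h1 : AnalyticAt ℝ p.sum (z - x) := hp.analyticAt_of_mem (by simp)
    exact h1.fun_comp (f := fun z => z - x) (analyticAt_id.sub analyticAt_const)
  -- The growth bound makes the Taylor series entire, but equality with g is known only near x. The
  -- identity theorem then extends it to the whole space.
  have hloc : g =ᶠ[𝓝 x] fun z => p.sum (z - x) := by
    obtain ⟨q, r, hq⟩ := hg x (Set.mem_univ x)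
    filter_upwards [Metric.eball_mem_nhds x hq.r_pos] with z hz
    have hz' : z - x ∈ Metric.eball (0 : E) r := by
      simpa [Metric.mem_eball, edist_eq_enorm_sub] using hz
    have h1 := hq.hasSum_iteratedFDeriv hz'
    have h2 : HasSum (fun k => p k fun _ => z - x) (p.sum (z - x)) := by
      simpa using hp.hasSum (y := z - x) (by simp)
    rw [add_sub_cancel] at h1
    exact h1.unique h2
  have heq := hg.eq_of_eventuallyEq hpx hloc
  have h2 : HasSum (fun k => p k fun _ => y) (p.sum y) := by
    simpa using hp.hasSum (y := y) (by simp)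
  rw [congrFun heq (x + y), add_sub_cancel_left]
  exact h2

/-- The derivatives of order at least two of `f` at `x`, evaluated on words whose letters have
weights related by `W`, are bounded by the factorial of the length times the product of the
weights. -/
def WordBound (f : E → V) (x : E) (W : E → ℝ → Prop) : Prop :=
  ∀ (k : ℕ) (w : Fin k → E) (a : Fin k → ℝ), 2 ≤ k → (∀ i, W (w i) (a i)) →
    ‖iteratedFDeriv ℝ k f x w‖ ≤ k.factorial * ∏ i, a i

namespace WordBound

variable {f : E → V} {x : E} {W : E → ℝ → Prop} {ι : Type*} {s : Finset ι} {w : ι → E} {a : ι → ℝ}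

/-- Multilinear expansion gives the sum over all words in the letters, and the products of their
weights add up to the k-th power of the total weight. -/
theorem norm_iteratedFDeriv_sum_le (hf : WordBound f x W) (hw : ∀ i ∈ s, W (w i) (a i)) {k : ℕ}
    (hk : 2 ≤ k) :
    ‖iteratedFDeriv ℝ k f x fun _ => ∑ i ∈ s, w i‖ ≤ k.factorial * (∑ i ∈ s, a i) ^ k := by
  classical
  rw [show (∑ i ∈ s, a i) ^ k = ∏ _j : Fin k, ∑ i ∈ s, a i by simp, Finset.prod_univ_sum,
    Finset.mul_sum]
  have := (iteratedFDeriv ℝ k f x).toMultilinearMap.map_sum_finset (fun _ => w) (fun _ => s)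
  rw [ContinuousMultilinearMap.coe_coe] at this
  rw [this]
  refine norm_sum_le_of_le _ fun r hr => hf k _ _ hk fun i => hw _ ?_
  exact Fintype.mem_piFinset.1 hr i

theorem norm_iteratedFDeriv_fderiv_sum_le (hf : WordBound f x W) (hw : ∀ i ∈ s, W (w i) (a i))
    {v : E} {b : ℝ} (hv : W v b) {k : ℕ} (hk : 1 ≤ k) :
    ‖(iteratedFDeriv ℝ k (fderiv ℝ f) x fun _ => ∑ i ∈ s, w i) v‖ ≤
      (k + 1).factorial * ((∑ i ∈ s, a i) ^ k * b) := by
  classical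
  rw [show (∑ i ∈ s, a i) ^ k = ∏ _j : Fin k, ∑ i ∈ s, a i by simp, Finset.prod_univ_sum,
    Finset.sum_mul, Finset.mul_sum]
  have := (iteratedFDeriv ℝ k (fderiv ℝ f) x).toMultilinearMap.map_sum_finset
    (fun _ => w) (fun _ => s)
  rw [ContinuousMultilinearMap.coe_coe] at this
  rw [this, sum_apply]
  refine norm_sum_le_of_le _ fun r hr => ?_
  have h1 := hf (k + 1) (Fin.snoc (fun i => w (r i)) v) (Fin.snoc (fun i => a (r i)) b)
    (by omega) (by
      intro i
      refine Fin.lastCases (by simpa using hv) (fun i => ?_) i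
      simpa using hw _ (Fintype.mem_piFinset.1 hr i))
  rw [iteratedFDeriv_succ_apply_right, Fin.prod_univ_castSucc] at h1
  simpa using h1

theorem norm_taylor_sub_le [CompleteSpace V] (hf : WordBound f x W)
    (hfa : AnalyticOnNhd ℝ f Set.univ) {C M : ℝ}
    (hC : ∀ k, ‖iteratedFDeriv ℝ k f x‖ ≤ C * M ^ k)
    (hw : ∀ i ∈ s, W (w i) (a i)) (ha : ∀ i ∈ s, 0 ≤ a i) (hσ : ∑ i ∈ s, a i ≤ 1 / 4) :
    ‖f (x + ∑ i ∈ s, w i) - f x - fderiv ℝ f x (∑ i ∈ s, w i)‖ ≤ 2 * (∑ i ∈ s, a i) ^ 2 := by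
  set σ := ∑ i ∈ s, a i with hσd
  have hσ0 : 0 ≤ σ := Finset.sum_nonneg ha
  have h1 := hfa.hasSum_iteratedFDeriv_of_norm_le x hC (∑ i ∈ s, w i)
  rw [← hasSum_nat_add_iff' 2] at h1
  have h2 : HasSum (fun k : ℕ => σ ^ 2 * σ ^ k) (σ ^ 2 * (1 - σ)⁻¹) :=
    (hasSum_geometric_of_lt_one hσ0 (by linarith)).mul_left _
  have h3 := h1.norm_le_of_bounded h2 (fun k => by
    have := hf.norm_iteratedFDeriv_sum_le hw (k := k + 2) (by omega)
    rw [norm_smul, norm_inv, Real.norm_natCast]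
    rw [inv_mul_le_iff₀ (by positivity)]
    refine this.trans_eq ?_
    rw [← hσd]; ring)
  have e : f (x + ∑ i ∈ s, w i) - f x - fderiv ℝ f x (∑ i ∈ s, w i) =
      f (x + ∑ i ∈ s, w i) - ∑ k ∈ Finset.range 2,
        (k.factorial : ℝ)⁻¹ • iteratedFDeriv ℝ k f x fun _ => ∑ i ∈ s, w i := by
    simp [Finset.sum_range_succ, sub_sub]
  rw [e]
  refine h3.trans ?_
  rw [mul_comm]
  gcongr
  rw [inv_le_comm₀ (by linarith) (by norm_num)]
  linarith

theorem norm_fderiv_taylor_sub_le [CompleteSpace V] (hf : WordBound f x W)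
    (hfa : AnalyticOnNhd ℝ f Set.univ) {C M : ℝ}
    (hC : ∀ k, ‖iteratedFDeriv ℝ k f x‖ ≤ C * M ^ k)
    (hw : ∀ i ∈ s, W (w i) (a i)) (ha : ∀ i ∈ s, 0 ≤ a i) (hσ : ∑ i ∈ s, a i ≤ 1 / 4)
    {v : E} {b : ℝ} (hv : W v b) (hb : 0 ≤ b) :
    ‖(fderiv ℝ f (x + ∑ i ∈ s, w i) - fderiv ℝ f x) v‖ ≤ 4 * (∑ i ∈ s, a i) * b := by
  set σ := ∑ i ∈ s, a i with hσd
  have hσ0 : 0 ≤ σ := Finset.sum_nonneg ha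
  have h1 := hfa.fderiv.hasSum_iteratedFDeriv_of_norm_le x (C := C * M) (M := M) (fun k => by
    rw [norm_iteratedFDeriv_fderiv]
    exact (hC (k + 1)).trans_eq (by ring)) (∑ i ∈ s, w i)
  rw [← hasSum_nat_add_iff' 1] at h1
  have h1' := h1.mapL (ContinuousLinearMap.apply ℝ V v)
  have h2 : HasSum (fun k : ℕ => 2 * σ * b * (2 * σ) ^ k) (2 * σ * b * (1 - 2 * σ)⁻¹) :=
    (hasSum_geometric_of_lt_one (by linarith) (by linarith)).mul_left _
  have h3 := h1'.norm_le_of_bounded h2 (fun k => by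
    have := hf.norm_iteratedFDeriv_fderiv_sum_le hw hv (k := k + 1) (by omega)
    simp only [ContinuousLinearMap.apply_apply, smul_apply, norm_smul,
      norm_inv, Real.norm_natCast]
    rw [inv_mul_le_iff₀ (by positivity)]
    refine this.trans ?_
    rw [← hσd, Nat.factorial_succ (k + 1)]
    push_cast
    -- The extra letter `v` leaves the factor k + 2 after dividing by the Taylor factorial. It is
    -- absorbed by doubling the ratio to 2σ, which is at most 1/2.
    have h4 : ((k : ℝ) + 1 + 1) ≤ 2 ^ (k + 1) := by
      exact_mod_cast (Nat.lt_two_pow_self (n := k + 1))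
    have h5 : (0 : ℝ) ≤ (k + 1).factorial * (σ ^ (k + 1) * b) := by positivity
    calc ((k : ℝ) + 1 + 1) * (k + 1).factorial * (σ ^ (k + 1) * b)
        = ((k : ℝ) + 1 + 1) * ((k + 1).factorial * (σ ^ (k + 1) * b)) := by ring
      _ ≤ 2 ^ (k + 1) * ((k + 1).factorial * (σ ^ (k + 1) * b)) := by gcongr
      _ = _ := by rw [mul_pow]; ring)
  have e : (fderiv ℝ f (x + ∑ i ∈ s, w i) - fderiv ℝ f x) v =
      ContinuousLinearMap.apply ℝ V v (fderiv ℝ f (x + ∑ i ∈ s, w i) - ∑ k ∈ Finset.range 1,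
        (k.factorial : ℝ)⁻¹ • iteratedFDeriv ℝ k (fderiv ℝ f) x fun _ => ∑ i ∈ s, w i) := by
    simp
  rw [e]
  refine h3.trans ?_
  have : (1 - 2 * σ)⁻¹ ≤ 2 := by
    rw [inv_le_comm₀ (by linarith) (by norm_num)]
    linarith
  calc 2 * σ * b * (1 - 2 * σ)⁻¹ ≤ 2 * σ * b * 2 := by gcongr
    _ = _ := by ring

end WordBound

end Taylor

/-! ### Words and correlation patterns -/

/-- Every word is, up to a permutation of its letters, given by the blocks of a composition with
monotone block sizes, with distinct letters in distinct blocks. -/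
theorem exists_composition_index_eq {α : Type*} {d : ℕ} (r : Fin d → α) :
    ∃ c : Composition d, Monotone c.blocksFun ∧ ∃ l : Fin c.length → α, Function.Injective l ∧
      (∀ i, l i ∈ Set.range r) ∧ ∃ π : Equiv.Perm (Fin d), ∀ k, r (π k) = l (c.index k) := by
  classical
  let A : Finset α := Finset.univ.image r
  let e₀ : Fin A.card ≃ A := A.equivFin.symm
  let cnt : Fin A.card → ℕ := fun i => Fintype.card {k // r k = e₀ i}
  -- Listing the letters by increasing multiplicity makes the block sizes monotone.
  let e : Fin A.card ≃ A := (Tuple.sort cnt).trans e₀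
  have hpos : ∀ i, 0 < cnt i := by
    intro i
    obtain ⟨k, -, hk⟩ := Finset.mem_image.1 (e₀ i).2
    exact Fintype.card_pos_iff.2 ⟨⟨k, hk⟩⟩
  have hsum : ∑ i, cnt (Tuple.sort cnt i) = d := by
    rw [Equiv.sum_comp (Tuple.sort cnt) cnt, ← Fintype.card_sigma]
    conv_rhs => rw [← Fintype.card_fin d]
    refine Fintype.card_congr
      ⟨fun p => p.2.1, fun k => ⟨e₀.symm ⟨r k, Finset.mem_image_of_mem _ (Finset.mem_univ k)⟩,
        ⟨k, by simp⟩⟩, ?_, fun k => rfl⟩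
    rintro ⟨i, k, hk⟩
    have : e₀.symm ⟨r k, Finset.mem_image_of_mem _ (Finset.mem_univ k)⟩ = i := by
      rw [Equiv.symm_apply_eq]; exact Subtype.ext hk
    subst this
    rfl
  let c : Composition d :=
    ⟨List.ofFn fun i => cnt (Tuple.sort cnt i), by
      intro i hi
      obtain ⟨j, rfl⟩ := List.mem_ofFn.1 hi
      exact hpos _, by rw [List.sum_ofFn, hsum]⟩
  have hlen : c.length = A.card := by simp [c, Composition.length]
  have hblock : ∀ i, c.blocksFun i = cnt (Tuple.sort cnt (Fin.cast hlen i)) := by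
    intro i
    simp [Composition.blocksFun, c, Fin.cast]
  let l : Fin c.length → α := fun i => e (Fin.cast hlen i)
  have hl : Function.Injective l := fun i j h => by
    have h' : e (Fin.cast hlen i) = e (Fin.cast hlen j) := Subtype.ext h
    exact Fin.cast_injective hlen (e.injective h')
  have hlr : ∀ i, l i ∈ Set.range r := by
    intro i
    obtain ⟨k, -, hk⟩ := Finset.mem_image.1 (show l i ∈ A from (e (Fin.cast hlen i)).2)
    exact ⟨k, hk⟩
  refine ⟨c, ?_, ?_⟩
  · intro i j hij
    rw [hblock, hblock]
    exact Tuple.monotone_sort cnt (show Fin.cast hlen i ≤ Fin.cast hlen j from hij)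
  · refine ⟨l, hl, hlr, ?_⟩
    -- Two words with the same multiplicity of every letter differ by a permutation: bijections
    -- between the fibres are glued.
    have hfib : ∀ i, Nonempty ({k // c.index k = i} ≃ {k // r k = l i}) := by
      intro i
      refine Fintype.card_eq.1 ?_
      have h1 : Fintype.card {k // c.index k = i} = c.blocksFun i := by
        rw [← Fintype.card_fin (c.blocksFun i)]
        refine (Fintype.card_congr (Equiv.ofBijective
          (fun j => (⟨c.embedding i j, c.index_embedding i j⟩ : {k // c.index k = i})) ⟨?_, ?_⟩)).symm
        · intro j j' h
          exact (c.embedding i).injective (Subtype.ext_iff.1 h)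
        · rintro ⟨k, rfl⟩
          exact ⟨c.invEmbedding k, Subtype.ext (c.embedding_comp_inv k)⟩
      rw [h1, hblock]
      rfl
    have hall : ∀ a : α, Nonempty ({k // l (c.index k) = a} ≃ {k // r k = a}) := by
      intro a
      by_cases ha : a ∈ Set.range l
      · obtain ⟨i, rfl⟩ := ha
        obtain ⟨f⟩ := hfib i
        exact ⟨(Equiv.subtypeEquivRight fun k => hl.eq_iff).trans f⟩
      · have : IsEmpty {k // l (c.index k) = a} := ⟨fun k => ha ⟨_, k.2⟩⟩
        have : IsEmpty {k // r k = a} := by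
          refine ⟨fun k => ha ?_⟩
          have hk : r k.1 ∈ A := Finset.mem_image_of_mem _ (Finset.mem_univ _)
          refine ⟨Fin.cast hlen.symm (e.symm ⟨r k.1, hk⟩), ?_⟩
          simpa [l] using k.2
        exact ⟨Equiv.equivOfIsEmpty _ _⟩
    let f := fun a => (hall a).some
    exact ⟨Equiv.ofFiberEquiv f, fun k => Equiv.ofFiberEquiv_map f k⟩

/-- A distinguished element `j` and distinct elements `l i ≠ j` of a finite initial segment are
the values at `0, 1, …` of a permutation of this segment. -/
theorem exists_perm_eq_of_injective {S k : ℕ} {j : ℕ} (hj : j ≤ S) {l : Fin k → ℕ}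
    (hl : Function.Injective l) (hlS : ∀ i, l i ≤ S) (hlj : ∀ i, l i ≠ j) :
    ∃ τ : Equiv.Perm (Finset.range (S + 1)), Equiv.Perm.ofSubtype τ 0 = j ∧
      ∀ i : Fin k, Equiv.Perm.ofSubtype τ (i + 1) = l i := by
  classical
  let g : Fin (k + 1) → (Finset.range (S + 1)) := Fin.cons ⟨j, by simp; omega⟩ fun i => ⟨l i, by have := hlS i; simp; omega⟩
  have hg : Function.Injective g := by
    refine Fin.cons_injective_iff.2 ⟨?_, fun a b h => hl (by simpa using h)⟩
    rintro ⟨i, hi⟩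
    exact hlj i (by simpa using hi)
  have hk : k ≤ S := by
    have := Fintype.card_le_of_injective g hg
    simp only [Fintype.card_fin, Fintype.card_coe, Finset.card_range] at this
    omega
  let g₀ : Fin (k + 1) → (Finset.range (S + 1)) := fun i => ⟨i, by simp; omega⟩
  have hg₀ : Function.Injective g₀ := fun a b h => Fin.ext (by simpa [g₀] using h)
  -- A bijection between two subsets of a finite set extends to a permutation. Staying inside the
  -- segment leaves only finitely many permutations, as a union bound needs.
  let e : {x // x ∈ Set.range g₀} ≃ {x // x ∈ Set.range g} :=
    (Equiv.ofInjective g₀ hg₀).symm.trans (Equiv.ofInjective g hg)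
  have he : ∀ i, (e.extendSubtype (g₀ i)) = g i := by
    intro i
    rw [Equiv.extendSubtype_apply_of_mem e (g₀ i) ⟨i, rfl⟩]
    simp only [e, Equiv.trans_apply]
    rw [Equiv.ofInjective_symm_apply hg₀ i]
    rfl
  refine ⟨e.extendSubtype, ?_, fun i => ?_⟩
  · rw [Equiv.Perm.ofSubtype_apply_of_mem _ (by simp : (0 : ℕ) ∈ Finset.range (S + 1))]
    have := he 0
    exact congrArg Subtype.val this
  · rw [Equiv.Perm.ofSubtype_apply_of_mem _ (by simp; omega : (i : ℕ) + 1 ∈ Finset.range (S + 1))]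
    have := he i.succ
    exact congrArg Subtype.val this

/-! ### Weights of words at the initial parameters -/

namespace GDML

variable {dX dY : ℕ} (G : GDML dX dY) (n : ℕ)

/-- The factor η^{D/2+d} of the correlation gives η to each gradient letter and √η to each free
letter, hence the 1/√η on the right. -/
theorem norm_iteratedFDeriv_append_le {D d : ℕ} {θ : Euc (G.N n)} {x₀ : G.X} {x : Fin d → G.X}
    {B : ℝ} (hB : ‖G.correlation n D d θ x₀ x‖ ≤ B) (u : Fin d → Euc dY)
    (v : Fin D → Euc (G.N n)) :
    ‖iteratedFDeriv ℝ (d + D) (fun θ' => G.F n θ' x₀) θ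
        (Fin.append (fun k => G.η n • G.jacT n θ (x k) (u k)) v)‖ ≤
      (D.factorial * d.factorial : ℝ) * (B * (∏ k, ‖u k‖) * ∏ k, (1 / √(G.η n)) * ‖v k‖) := by
  have hη := G.η_pos n
  have h1 : ‖G.correlation n D d θ x₀ x u v‖ ≤ B * (∏ k, ‖u k‖) * ∏ k, ‖v k‖ := by
    refine ((G.correlation n D d θ x₀ x u).le_opNorm v).trans ?_
    gcongr
    exact ((G.correlation n D d θ x₀ x).le_opNorm u).trans (by gcongr)
  rw [correlation_apply, norm_smul] at h1
  have h2 : Fin.append (fun k => G.η n • G.jacT n θ (x k) (u k)) v =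
      fun i => Fin.append (fun _ => G.η n) (fun _ => (1 : ℝ)) i •
        Fin.append (fun k => G.jacT n θ (x k) (u k)) v i := by
    funext i
    refine Fin.addCases (fun j => ?_) (fun j => ?_) i <;> simp
  rw [h2, ContinuousMultilinearMap.map_smul_univ, norm_smul, Fin.prod_univ_add]
  simp only [Fin.append_left, Fin.append_right, Finset.prod_const, Finset.card_univ,
    Fintype.card_fin, one_pow, mul_one, Finset.prod_mul_distrib]
  have h3 : G.η n ^ ((D : ℝ) / 2 + d) = √(G.η n) ^ D * G.η n ^ d := by
    rw [Real.rpow_add hη, Real.rpow_natCast, Real.sqrt_eq_rpow, ← Real.rpow_mul_natCast hη.le]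
    congr 2
    ring
  have hs : 0 < √(G.η n) := Real.sqrt_pos.2 hη
  rw [h3, Real.norm_of_nonneg (by positivity)] at h1
  rw [Real.norm_of_nonneg (by positivity)]
  generalize ‖iteratedFDeriv ℝ (d + D) (fun θ' => G.F n θ' x₀) θ
    (Fin.append (fun k => G.jacT n θ (x k) (u k)) v)‖ = A at h1 ⊢
  rw [div_mul_eq_mul_div, div_le_iff₀ (by positivity)] at h1
  have h4 : G.η n ^ d * A ≤ (B * (∏ k, ‖u k‖) * (∏ k, ‖v k‖) * (D.factorial * d.factorial)) /
      √(G.η n) ^ D := by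
    rw [le_div_iff₀ (by positivity)]
    calc G.η n ^ d * A * √(G.η n) ^ D = √(G.η n) ^ D * G.η n ^ d * A := by ring
      _ ≤ _ := h1
  refine h4.trans_eq ?_
  rw [one_div, inv_pow]
  ring

/-- The weights of parameter directions: `η ∇F(θ)(p r) u` with `r ∈ A` has weight `κ ‖u‖`, and
an arbitrary direction `w` has weight `K ‖w‖ / √η`. -/
def Weight (θ : Euc (G.N n)) (p : ℕ → G.X) (A : Set ℕ) (K κ : ℝ) (w : Euc (G.N n)) (a : ℝ) :
    Prop :=
  a = K / √(G.η n) * ‖w‖ ∨ ∃ r ∈ A, ∃ u, w = G.η n • G.jacT n θ (p r) u ∧ a = κ * ‖u‖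

/-- Bounds of the derivatives of `F` at `θ` on the points `p 0, …, p S`, by powers of `K`, and
of the derivative correlations between these points, by powers of `κ`. -/
structure DerivBounds (S : ℕ) (θ : Euc (G.N n)) (p : ℕ → G.X) (K κ : ℝ) : Prop where
  deriv_le : ∀ j ≤ S, ∀ k, 1 ≤ k → ‖G.deriv n k θ (p j)‖ ≤ (K / √(G.η n)) ^ k
  correlation_le : ∀ (τ : Equiv.Perm (Finset.range (S + 1))) (i : CorrIndex),
    ‖G.correlation n i.D i.d θ (p (Equiv.Perm.ofSubtype τ 0))
      (fun k => p (Equiv.Perm.ofSubtype τ (i.mult.index k + 1)))‖ ≤ κ ^ i.d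

variable {G n} {S : ℕ} {θ : Euc (G.N n)} {p : ℕ → G.X} {K κ : ℝ}

theorem iteratedFDeriv_F_comp_perm (x : G.X) {k : ℕ} (w : Fin k → Euc (G.N n))
    (σ : Equiv.Perm (Fin k)) :
    iteratedFDeriv ℝ k (fun θ' => G.F n θ' x) θ (w ∘ σ) =
      iteratedFDeriv ℝ k (fun θ' => G.F n θ' x) θ w :=
  (G.F_analytic n x θ (Set.mem_univ θ)).contDiffAt.iteratedFDeriv_comp_perm w σ

/-- The correlation bounds concern only words sorted into blocks of increasing size, with the inputs
in a prescribed order. Symmetry of the derivative sorts the letters, and a permutation of the points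
relabels the inputs. It must send 0 to `j`, so `j` cannot occur among the letters. -/
theorem DerivBounds.norm_word_le (h : G.DerivBounds n S θ p K κ) {j : ℕ} (hj : j ≤ S)
    {D d : ℕ} (hd : 1 ≤ d) (hDd : (D, d) ≠ (0, 1)) {r : Fin d → ℕ} (hrS : ∀ k, r k ≤ S)
    (hrj : ∀ k, r k ≠ j) (u : Fin d → Euc dY) (v : Fin D → Euc (G.N n)) :
    ‖iteratedFDeriv ℝ (d + D) (fun θ' => G.F n θ' (p j)) θ
        (Fin.append (fun k => G.η n • G.jacT n θ (p (r k)) (u k)) v)‖ ≤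
      (D.factorial * d.factorial : ℝ) *
        (κ ^ d * (∏ k, ‖u k‖) * ∏ k, (1 / √(G.η n)) * ‖v k‖) := by
  obtain ⟨c, hc, l, hl, hlr, π, hπ⟩ := exists_composition_index_eq r
  obtain ⟨τ, hτ0, hτ⟩ := exists_perm_eq_of_injective hj hl
    (fun i => by obtain ⟨k, hk⟩ := hlr i; exact hk ▸ hrS k)
    (fun i => by obtain ⟨k, hk⟩ := hlr i; exact hk ▸ hrj k)
  have h1 := h.correlation_le τ ⟨D, d, hd, hDd, c, hc⟩
  simp only [hτ0, hτ] at h1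
  have h2 := G.norm_iteratedFDeriv_append_le n h1 (u ∘ π) v
  let σ : Equiv.Perm (Fin (d + D)) :=
    finSumFinEquiv.symm.trans ((Equiv.sumCongr π (Equiv.refl _)).trans finSumFinEquiv)
  have h3 : (Fin.append (fun k => G.η n • G.jacT n θ (p (l (c.index k))) ((u ∘ π) k)) v) =
      (Fin.append (fun k => G.η n • G.jacT n θ (p (r k)) (u k)) v) ∘ σ := by
    funext i
    refine Fin.addCases (fun j => ?_) (fun j => ?_) i
    · simp [σ, ← hπ]
    · simp [σ]
  rw [h3, iteratedFDeriv_F_comp_perm] at h2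
  refine h2.trans_eq ?_
  congr 3
  exact Equiv.prod_comp π fun k => ‖u k‖

/-- A word without gradient letters is controlled by the operator norm of the derivative; any other
word is contracted from a correlation with d ≥ 1 gradient letters and D free ones. The excluded pair
(0, 1) has length one. -/
theorem DerivBounds.wordBound (h : G.DerivBounds n S θ p K κ) (hκ : 0 ≤ κ) (hK : 1 ≤ K) {j : ℕ}
    (hj : j ≤ S) {A : Set ℕ} (hA : ∀ r ∈ A, r ≤ S ∧ r ≠ j) :
    WordBound (fun θ' => G.F n θ' (p j)) θ (G.Weight n θ p A K κ) := by
  classical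
  intro k w a hk hw
  have hs : 0 < √(G.η n) := Real.sqrt_pos.2 (G.η_pos n)
  let L : Finset (Fin k) := Finset.univ.filter fun i =>
    ∃ r ∈ A, ∃ u, w i = G.η n • G.jacT n θ (p r) u ∧ a i = κ * ‖u‖
  have hLc : ∀ i ∈ Lᶜ, a i = K / √(G.η n) * ‖w i‖ := by
    intro i hi
    refine (hw i).resolve_right fun h' => ?_
    exact (Finset.mem_compl.1 hi) (Finset.mem_filter.2 ⟨Finset.mem_univ _, h'⟩)
  obtain hL | hL := L.eq_empty_or_nonempty
  · have h1 := (G.deriv n k θ (p j)).le_of_opNorm_le (h.deriv_le j hj k (by omega)) w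
    have h2 : ∏ i, a i = (K / √(G.η n)) ^ k * ∏ i, ‖w i‖ := by
      rw [Finset.prod_congr rfl fun i _ => hLc i (by simp [hL]), Finset.prod_mul_distrib,
        Finset.prod_const, Finset.card_univ, Fintype.card_fin]
    rw [h2]
    refine h1.trans (le_mul_of_one_le_left (by positivity) ?_)
    exact_mod_cast Nat.one_le_iff_ne_zero.2 k.factorial_ne_zero
  · obtain ⟨d, D, hk', hd, e, he, he'⟩ : ∃ d D : ℕ, k = d + D ∧ 1 ≤ d ∧
        ∃ e : Fin d ⊕ Fin D ≃ Fin k, (∀ i, e (Sum.inl i) ∈ L) ∧ ∀ i, e (Sum.inr i) ∈ Lᶜ := by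
      refine ⟨L.card, Lᶜ.card, by rw [Finset.card_add_card_compl, Fintype.card_fin],
        Finset.card_pos.2 hL, finSumEquivOfFinset rfl rfl, fun i => ?_, fun i => ?_⟩
      · simp only [finSumEquivOfFinset_inl]
        exact Finset.orderEmbOfFin_mem _ _ _
      · simp only [finSumEquivOfFinset_inr]
        exact Finset.orderEmbOfFin_mem _ _ _
    subst hk'
    choose r hrA u hwu hau using fun i => (Finset.mem_filter.1 (he i)).2
    have h1 := h.norm_word_le hj (D := D) hd (by
        rintro h'
        simp only [Prod.mk.injEq] at h'
        omega) (fun i => (hA _ (hrA i)).1) (fun i => (hA _ (hrA i)).2) u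
        (fun i => w (e (Sum.inr i)))
    let σ : Equiv.Perm (Fin (d + D)) := finSumFinEquiv.symm.trans e
    have h2 : Fin.append (fun i => G.η n • G.jacT n θ (p (r i)) (u i))
        (fun i => w (e (Sum.inr i))) = w ∘ σ := by
      funext i
      refine Fin.addCases (fun j => ?_) (fun j => ?_) i
      · simp [σ, hwu]
      · simp [σ]
    rw [h2, iteratedFDeriv_F_comp_perm] at h1
    refine h1.trans ?_
    have h3 : ∏ i, a i = (κ ^ d * ∏ i, ‖u i‖) * ∏ i, K / √(G.η n) * ‖w (e (Sum.inr i))‖ := by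
      rw [← Equiv.prod_comp e, Fintype.prod_sum_type]
      simp_rw [hau, fun i => hLc _ (he' i)]
      simp [Finset.prod_mul_distrib]
    rw [h3]
    -- What remains is D! d! ≤ (D + d)!, and 1 ≤ K for each free letter.
    gcongr
    rw [add_comm d D]
    exact_mod_cast Nat.le_of_dvd (Nat.factorial_pos _) (Nat.factorial_mul_factorial_dvd_factorial_add D d)

theorem DerivBounds.norm_iteratedFDeriv_le (h : G.DerivBounds n S θ p K κ) (hK : 0 ≤ K) {j : ℕ}
    (hj : j ≤ S) (k : ℕ) :
    ‖iteratedFDeriv ℝ k (fun θ' => G.F n θ' (p j)) θ‖ ≤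
      max 1 ‖G.F n θ (p j)‖ * (K / √(G.η n)) ^ k := by
  obtain rfl | hk := k.eq_zero_or_pos
  · simp
  · refine (h.deriv_le j hj k hk).trans (le_mul_of_one_le_left (by positivity) (le_max_left _ _))

/-! ### The displacement of the parameters under training -/

variable (G n)

/-- The gradients of the cost at the labels of `p 0, …, p S` are bounded by and Lipschitz with
constant `Λ` on the ball of radius `R`. -/
def CostBounds (S : ℕ) (p : ℕ → G.X) (R Λ : ℝ) : Prop :=
  ∀ a ≤ S, (∀ z, ‖z‖ ≤ R → ‖G.cost' z (G.target (p a))‖ ≤ Λ) ∧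
    ∀ z z', ‖z‖ ≤ R → ‖z'‖ ≤ R →
      ‖G.cost' z (G.target (p a)) - G.cost' z' (G.target (p a))‖ ≤ Λ * ‖z - z'‖

/-- The displacement of the parameters after `s` training steps is a sum of steps
`η ∇F(θ)(x_r) u_r` with the gradient at the initial parameters and of a correction `b`, which is
of order `√η κ`, and of order `κ²` in the directions of the gradients at the points not used yet. -/
structure Displacement (S s : ℕ) (θ : Euc (G.N n)) (p : ℕ → G.X) (Λ κ C : ℝ) (u : ℕ → Euc dY)
    (b : Euc (G.N n)) : Prop where
  train_eq : G.train n θ (fun i => p (i + 1)) s =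
    θ + (b + ∑ r ∈ Finset.range s, G.η n • G.jacT n θ (p (r + 1)) (u r))
  norm_step_le : ∀ r, ‖u r‖ ≤ Λ
  norm_correction_le : ‖b‖ ≤ √(G.η n) * (C * κ)
  norm_jac_correction_le : ∀ a ≤ S, a = 0 ∨ s < a → ‖G.jac n θ (p a) b‖ ≤ C * κ ^ 2
  norm_sub_Flin_le : ∀ a ≤ S,
    ‖G.F n θ (p a) + G.jac n θ (p a)
        (∑ r ∈ Finset.range s, G.η n • G.jacT n θ (p (r + 1)) (u r)) -
      G.Flin n θ (fun i => p (i + 1)) s (p a)‖ ≤ C * κ ^ 2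

variable {G n} {S s : ℕ} {θ : Euc (G.N n)} {p : ℕ → G.X} {K κ Λ R C : ℝ} {u : ℕ → Euc dY}
  {b : Euc (G.N n)}

/-- The correction is one free letter, indexed by `none`, whose norm bound √η Cκ compensates the
1/√η in its weight; each step is a gradient letter at a point 1, …, s, hence different from the
unused `j`. -/
theorem Displacement.exists_weights (h : G.Displacement n S s θ p Λ κ C u b)
    (hκ : 0 ≤ κ) (hK : 1 ≤ K) (hsS : s ≤ S) {j : ℕ} (hjs : j = 0 ∨ s < j) :
    ∃ (w : Option ℕ → Euc (G.N n)) (a : Option ℕ → ℝ),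
      b + ∑ r ∈ Finset.range s, G.η n • G.jacT n θ (p (r + 1)) (u r) =
        ∑ i ∈ Finset.insertNone (Finset.range s), w i ∧
      (∀ i ∈ Finset.insertNone (Finset.range s),
        G.Weight n θ p {r | r ≤ S ∧ r ≠ j} K κ (w i) (a i)) ∧
      (∀ i ∈ Finset.insertNone (Finset.range s), 0 ≤ a i) ∧
      ∑ i ∈ Finset.insertNone (Finset.range s), a i ≤ (S * Λ + K * C) * κ := by
  have hs : 0 < √(G.η n) := Real.sqrt_pos.2 (G.η_pos n)
  have hΛ : 0 ≤ Λ := (norm_nonneg _).trans (h.norm_step_le 0)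
  refine ⟨fun i => i.elim b fun r => G.η n • G.jacT n θ (p (r + 1)) (u r),
    fun i => i.elim (K / √(G.η n) * ‖b‖) fun r => κ * ‖u r‖, ?_, ?_, ?_, ?_⟩
  · simp [Finset.sum_insertNone]
  · intro i hi
    cases i with
    | none => exact Or.inl rfl
    | some r =>
      have hr : r < s := by simpa using hi
      exact Or.inr ⟨r + 1, ⟨by omega, by omega⟩, u r, rfl, rfl⟩
  · intro i hi
    cases i with
    | none => simp only [Option.elim]; positivity
    | some r => simp only [Option.elim]; positivity
  · rw [Finset.sum_insertNone]
    simp only [Option.elim]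
    have h1 : K / √(G.η n) * ‖b‖ ≤ K * C * κ := by
      calc K / √(G.η n) * ‖b‖ ≤ K / √(G.η n) * (√(G.η n) * (C * κ)) := by
            gcongr; exact h.norm_correction_le
        _ = K * C * κ := by field_simp
    have h2 : ∑ r ∈ Finset.range s, κ * ‖u r‖ ≤ S * (κ * Λ) := by
      refine (Finset.sum_le_card_nsmul _ _ (κ * Λ) fun r _ => ?_).trans ?_
      · gcongr; exact h.norm_step_le r
      · rw [Finset.card_range, nsmul_eq_mul]; gcongr
    linarith

/-- Three errors of order κ² add up: the Taylor remainder, the gradient applied to the correction,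
and the gap between the linear part and the linearised training. -/
theorem Displacement.norm_train_sub_Flin_le (h : G.Displacement n S s θ p Λ κ C u b)
    (hd : G.DerivBounds n S θ p K κ) (hκ : 0 ≤ κ) (hK : 1 ≤ K)
    (hB : (S * Λ + K * C) * κ ≤ 1 / 4) (hsS : s ≤ S) {j : ℕ} (hj : j ≤ S)
    (hjs : j = 0 ∨ s < j) :
    ‖G.F n (G.train n θ (fun i => p (i + 1)) s) (p j) -
        G.Flin n θ (fun i => p (i + 1)) s (p j)‖ ≤
      (2 * (S * Λ + K * C) ^ 2 + 2 * C) * κ ^ 2 := by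
  obtain ⟨w, a, hw, hwa, ha, hσ⟩ := h.exists_weights hκ hK hsS hjs
  have h1 := (hd.wordBound hκ hK hj (A := {r | r ≤ S ∧ r ≠ j}) fun r hr => hr).norm_taylor_sub_le
    (G.F_analytic n (p j)) (hd.norm_iteratedFDeriv_le (by linarith) hj) hwa ha (hσ.trans hB)
  rw [← hw, ← h.train_eq] at h1
  have h2 : 2 * (∑ i ∈ Finset.insertNone (Finset.range s), a i) ^ 2 ≤
      2 * ((S * Λ + K * C) * κ) ^ 2 := by
    have := Finset.sum_nonneg ha
    gcongr
  have h3 := h.norm_jac_correction_le j hj hjs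
  have h4 := h.norm_sub_Flin_le j hj
  change ‖_ - _ - G.jac n θ (p j) _‖ ≤ _ at h1
  rw [map_add] at h1
  have h5 := norm_add_le_of_le (norm_add_le_of_le (h1.trans h2) h3) h4
  refine (le_of_eq ?_).trans (h5.trans_eq (by ring))
  congr 1
  abel

theorem Displacement.norm_jac_train_sub_apply_le (h : G.Displacement n S s θ p Λ κ C u b)
    (hd : G.DerivBounds n S θ p K κ) (hκ : 0 ≤ κ) (hK : 1 ≤ K)
    (hB : (S * Λ + K * C) * κ ≤ 1 / 4) (hsS : s ≤ S) {j : ℕ} (hj : j ≤ S)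
    (hjs : j = 0 ∨ s < j) {v : Euc (G.N n)} {β : ℝ}
    (hv : G.Weight n θ p {r | r ≤ S ∧ r ≠ j} K κ v β) (hβ : 0 ≤ β) :
    ‖(G.jac n (G.train n θ (fun i => p (i + 1)) s) (p j) - G.jac n θ (p j)) v‖ ≤
      4 * ((S * Λ + K * C) * κ) * β := by
  obtain ⟨w, a, hw, hwa, ha, hσ⟩ := h.exists_weights hκ hK hsS hjs
  have h1 := (hd.wordBound hκ hK hj (A := {r | r ≤ S ∧ r ≠ j})
    fun r hr => hr).norm_fderiv_taylor_sub_le (G.F_analytic n (p j))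
    (hd.norm_iteratedFDeriv_le (by linarith) hj) hwa ha (hσ.trans hB) hv hβ
  rw [← hw, ← h.train_eq] at h1
  exact h1.trans (by gcongr)

theorem DerivBounds.norm_jac_le (hd : G.DerivBounds n S θ p K κ) {j : ℕ} (hj : j ≤ S) :
    ‖G.jac n θ (p j)‖ ≤ K / √(G.η n) := by
  have := hd.deriv_le j hj 1 le_rfl
  rwa [deriv, norm_iteratedFDeriv_one, pow_one] at this

theorem DerivBounds.norm_smul_jac_jacT_le (hd : G.DerivBounds n S θ p K κ) (hK : 0 ≤ K)
    {i j : ℕ} (hi : i ≤ S) (hj : j ≤ S) (y : Euc dY) :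
    ‖G.η n • G.jac n θ (p i) (G.jacT n θ (p j) y)‖ ≤ K ^ 2 * ‖y‖ := by
  have hη := G.η_pos n
  have hs : 0 < √(G.η n) := Real.sqrt_pos.2 hη
  rw [norm_smul, Real.norm_of_nonneg hη.le]
  have h2 : ‖G.jacT n θ (p j) y‖ ≤ K / √(G.η n) * ‖y‖ := by
    refine ContinuousLinearMap.le_of_opNorm_le _ ?_ y
    rw [jacT, LinearIsometryEquiv.norm_map]
    exact hd.norm_jac_le hj
  calc G.η n * ‖G.jac n θ (p i) (G.jacT n θ (p j) y)‖
      ≤ G.η n * (K / √(G.η n) * (K / √(G.η n) * ‖y‖)) := by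
        gcongr
        exact (ContinuousLinearMap.le_of_opNorm_le _ (hd.norm_jac_le hi) _).trans (by gcongr)
    _ = K ^ 2 * ‖y‖ * (G.η n / √(G.η n) ^ 2) := by ring
    _ = _ := by rw [Real.sq_sqrt hη.le, div_self hη.ne', mul_one]

/-- The new step is split into the same step with the gradient frozen at θ₀, which becomes a new
letter, and a remainder `t` from the gradient's movement `T`, which joins the correction. -/
theorem Displacement.succ (h : G.Displacement n S s θ p Λ κ C u b)
    (hd : G.DerivBounds n S θ p K κ) (hc : G.CostBounds S p (R + 1) Λ) (hκ : 0 ≤ κ) (hK : 1 ≤ K)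
    (hC : 0 ≤ C)
    (hB : (S * Λ + K * C) * κ ≤ 1 / 4) (hD : (2 * (S * Λ + K * C) ^ 2 + 2 * C) * κ ^ 2 ≤ 1)
    (hsS : s + 1 ≤ S)
    (hR : ‖G.Flin n θ (fun i => p (i + 1)) s (p (s + 1))‖ ≤ R) :
    ∃ u' b', G.Displacement n S (s + 1) θ p Λ κ
      (C + 4 * (S * Λ + K * C) * K * Λ +
        K ^ 2 * (Λ * (2 * (S * Λ + K * C) ^ 2 + 2 * C))) u' b' := by
  classical
  have hη := G.η_pos n
  have hs : 0 < √(G.η n) := Real.sqrt_pos.2 hη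
  have hΛ : 0 ≤ Λ := (norm_nonneg _).trans (h.norm_step_le 0)
  set B : ℝ := S * Λ + K * C with hBdef
  have hB0 : 0 ≤ B := by positivity
  set D : ℝ := 2 * B ^ 2 + 2 * C with hDdef
  have hD0 : 0 ≤ D := by positivity
  have hdev := h.norm_train_sub_Flin_le hd hκ hK hB (by omega) hsS (Or.inr (Nat.lt_succ_self s))
  rw [← hBdef, ← hDdef] at hdev
  set θ' := G.train n θ (fun i => p (i + 1)) s with hθ'
  set zl := G.Flin n θ (fun i => p (i + 1)) s (p (s + 1)) with hzl
  set z := G.F n θ' (p (s + 1)) with hz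
  -- The deviation is at most 1 by `hD`, which is why the cost is controlled on the radius R + 1.
  have hzR : ‖z‖ ≤ R + 1 := by
    have := norm_le_norm_add_norm_sub' z zl
    linarith
  set e := -(G.cost' z (G.target (p (s + 1)))) with he
  have heΛ : ‖e‖ ≤ Λ := by rw [he, norm_neg]; exact (hc _ hsS).1 z hzR
  have hed : ‖e + G.cost' zl (G.target (p (s + 1)))‖ ≤ Λ * (D * κ ^ 2) := by
    have h1 := (hc _ hsS).2 z zl hzR (by linarith)
    rw [he, neg_add_eq_sub, norm_sub_rev]
    exact h1.trans (by gcongr)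
  set T := G.jac n θ' (p (s + 1)) - G.jac n θ (p (s + 1)) with hT
  have hTv : ∀ v β, G.Weight n θ p {r | r ≤ S ∧ r ≠ s + 1} K κ v β → 0 ≤ β →
      ‖T v‖ ≤ 4 * (B * κ) * β := fun v β hv hβ =>
    h.norm_jac_train_sub_apply_le hd hκ hK hB (by omega) hsS (Or.inr (Nat.lt_succ_self s)) hv hβ
  set t := G.η n • ContinuousLinearMap.adjoint T e with ht
  have htn : ‖t‖ ≤ √(G.η n) * (4 * B * K * Λ * κ) := by
    have h1 : ‖T‖ ≤ 4 * (B * κ) * (K / √(G.η n)) :=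
      T.opNorm_le_bound (by positivity) fun v =>
        (hTv v _ (Or.inl rfl) (by positivity)).trans_eq (by ring)
    rw [ht, norm_smul, Real.norm_of_nonneg hη.le]
    calc G.η n * ‖ContinuousLinearMap.adjoint T e‖
        ≤ G.η n * (4 * (B * κ) * (K / √(G.η n)) * Λ) := by
          gcongr
          exact ContinuousLinearMap.le_of_opNorm_le_of_le _
            ((LinearIsometryEquiv.norm_map _ _).trans_le h1) heΛ
      _ = G.η n / √(G.η n) * (4 * B * K * Λ * κ) := by ring
      _ = _ := by rw [Real.div_sqrt]
  -- Transposing turns the pairing of `t` with a gradient into `T` applied to a gradient letter. Its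
  -- weight supplies the second factor κ, which the norm bound on `t` lacks.
  have htj : ∀ a ≤ S, a ≠ s + 1 → ‖G.jac n θ (p a) t‖ ≤ 4 * B * Λ * κ ^ 2 := by
    intro a haS has
    have h1 : ‖T ∘L (G.η n • G.jacT n θ (p a))‖ ≤ 4 * B * κ ^ 2 :=
      ContinuousLinearMap.opNorm_le_bound _ (by positivity) fun y =>
        (hTv _ _ (Or.inr ⟨a, ⟨haS, has⟩, y, rfl, rfl⟩) (by positivity)).trans_eq (by ring)
    have h2 : G.jac n θ (p a) t =
        ContinuousLinearMap.adjoint (T ∘L (G.η n • G.jacT n θ (p a))) e := by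
      have h3 : ContinuousLinearMap.adjoint (G.η n • G.jacT n θ (p a)) =
          G.η n • G.jac n θ (p a) := by
        rw [map_smulₛₗ, jacT, ContinuousLinearMap.adjoint_adjoint]
        rfl
      rw [ContinuousLinearMap.adjoint_comp, h3, ht, map_smul]
      rfl
    rw [h2]
    exact (ContinuousLinearMap.le_of_opNorm_le_of_le _
      ((LinearIsometryEquiv.norm_map _ _).trans_le h1) heΛ).trans_eq (by ring)
  have hsum : ∑ r ∈ Finset.range (s + 1),
        G.η n • G.jacT n θ (p (r + 1)) (Function.update u s e r) =
      ∑ r ∈ Finset.range s, G.η n • G.jacT n θ (p (r + 1)) (u r) +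
        G.η n • G.jacT n θ (p (s + 1)) e := by
    rw [Finset.sum_range_succ, Function.update_self]
    congr 1
    refine Finset.sum_congr rfl fun r hr => ?_
    rw [Function.update_of_ne (Finset.mem_range.1 hr).ne]
  have hX : 0 ≤ 4 * B * K * Λ := by positivity
  have hX' : 4 * B * Λ ≤ 4 * B * K * Λ := by
    have : 4 * B * Λ * 1 ≤ 4 * B * Λ * K := by gcongr
    linarith
  have hY : 0 ≤ K ^ 2 * (Λ * D) := by positivity
  refine ⟨Function.update u s e, b + t, ?_, ?_, ?_, ?_, ?_⟩
  · rw [hsum, train]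
    change θ' - G.η n • G.jacT n θ' (p (s + 1)) (G.cost' z (G.target (p (s + 1)))) = _
    have h1 : t = G.η n • G.jacT n θ' (p (s + 1)) e - G.η n • G.jacT n θ (p (s + 1)) e := by
      rw [ht, hT, map_sub, sub_apply, smul_sub]
      rfl
    have h2 : G.η n • G.jacT n θ' (p (s + 1)) e =
        - (G.η n • G.jacT n θ' (p (s + 1)) (G.cost' z (G.target (p (s + 1))))) := by
      rw [he, map_neg, smul_neg]
    rw [h1, h2, hθ', h.train_eq]
    abel
  · intro r
    obtain rfl | hr := eq_or_ne r s
    · rwa [Function.update_self]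
    · rw [Function.update_of_ne hr]; exact h.norm_step_le r
  · have h1 := norm_add_le_of_le h.norm_correction_le htn
    refine h1.trans ?_
    rw [← mul_add, ← add_mul]
    exact mul_le_mul_of_nonneg_left (mul_le_mul_of_nonneg_right (by linarith) hκ) hs.le
  · intro a haS has
    rw [map_add]
    refine (norm_add_le_of_le (h.norm_jac_correction_le a haS (by omega))
      (htj a haS (by omega))).trans ?_
    rw [← add_mul]
    exact mul_le_mul_of_nonneg_right (by linarith) (sq_nonneg κ)
  -- Both sides move by the frozen kernel, so only the difference of the two cost gradients, of
  -- order κ², enters. No correlation is used, so already used points are allowed.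
  · intro a haS
    have hF : G.Flin n θ (fun i => p (i + 1)) (s + 1) (p a) =
        G.Flin n θ (fun i => p (i + 1)) s (p a) - G.η n • G.jac n θ (p a)
          (G.jacT n θ (p (s + 1)) (G.cost' zl (G.target (p (s + 1))))) := rfl
    rw [hsum, map_add, hF]
    have h1 := h.norm_sub_Flin_le a haS
    have h2 := hd.norm_smul_jac_jacT_le (by linarith : 0 ≤ K) haS hsS
      (e + G.cost' zl (G.target (p (s + 1))))
    have h3 := norm_add_le_of_le h1 h2
    have h4 : C * κ ^ 2 + K ^ 2 * ‖e + G.cost' zl (G.target (p (s + 1)))‖ ≤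
        (C + 4 * B * K * Λ + K ^ 2 * (Λ * D)) * κ ^ 2 := by
      calc _ ≤ C * κ ^ 2 + K ^ 2 * (Λ * (D * κ ^ 2)) := by gcongr
        _ = (C + K ^ 2 * (Λ * D)) * κ ^ 2 := by ring
        _ ≤ _ := mul_le_mul_of_nonneg_right (by linarith) (sq_nonneg κ)
    refine (le_of_eq ?_).trans (h3.trans h4)
    congr 1
    rw [map_add, map_add, smul_add]
    simp only [map_smul]
    abel

theorem displacement_zero (hΛ : 0 ≤ Λ) :
    G.Displacement n S 0 θ p Λ κ 0 0 0 where
  train_eq := by simp [train]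
  norm_step_le r := by simpa using hΛ
  norm_correction_le := by simp
  norm_jac_correction_le a _ _ := by simp
  norm_sub_Flin_le a _ := by simp [Flin]

theorem exists_displacement (S s : ℕ) {K Λ : ℝ} (R : ℝ) (hK : 1 ≤ K) (hΛ : 0 ≤ Λ) :
    ∃ C : ℝ, 0 ≤ C ∧ ∃ M : ℝ, 0 ≤ M ∧
      ∀ (n : ℕ) (θ : Euc (G.N n)) (p : ℕ → G.X) (κ : ℝ), 0 ≤ κ → M * κ ≤ 1 → s ≤ S →
        G.DerivBounds n S θ p K κ → G.CostBounds S p (R + 1) Λ →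
        (∀ s ≤ S, ∀ a ≤ S, ‖G.Flin n θ (fun i => p (i + 1)) s (p a)‖ ≤ R) →
        ∃ u b, G.Displacement n S s θ p Λ κ C u b := by
  induction s with
  | zero =>
    exact ⟨0, le_rfl, 0, le_rfl, fun n θ p κ _ _ _ _ _ _ => ⟨0, 0, displacement_zero hΛ⟩⟩
  | succ s ih =>
    obtain ⟨C, hC, M, hM, h⟩ := ih
    have hB : 0 ≤ S * Λ + K * C := by positivity
    refine ⟨C + 4 * (S * Λ + K * C) * K * Λ + K ^ 2 * (Λ * (2 * (S * Λ + K * C) ^ 2 + 2 * C)),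
      -- The summands serve the previous step, the total weight at most 1/4, the deviation at most
      -- 1, and κ ≤ 1, which lowers κ² to κ.
      by positivity, M + 4 * (S * Λ + K * C) + (2 * (S * Λ + K * C) ^ 2 + 2 * C) + 1,
      by positivity, ?_⟩
    intro n θ p κ hκ hMκ hsS hd hc hR
    have hD : 0 ≤ 2 * (S * Λ + K * C) ^ 2 + 2 * C := by positivity
    have h1 : 0 ≤ M * κ := by positivity
    have h2 : 0 ≤ (S * Λ + K * C) * κ := by positivity
    have h3 : 0 ≤ (2 * (S * Λ + K * C) ^ 2 + 2 * C) * κ := by positivity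
    have hκ1 : κ ≤ 1 := by linarith
    obtain ⟨u, b, hub⟩ := h n θ p κ hκ (by linarith) (by omega) hd hc hR
    refine hub.succ hd hc hκ hK hC (by linarith) ?_ hsS (hR s (by omega) _ hsS)
    have h4 : (2 * (S * Λ + K * C) ^ 2 + 2 * C) * κ * κ ≤
      (2 * (S * Λ + K * C) ^ 2 + 2 * C) * κ * 1 := by gcongr
    linarith

/-- On bounded data, the deviation of the trained hypothesis function from its linearisation at
the test point is of the second order in the size of the correlations. -/
theorem exists_norm_train_sub_Flin_le (S : ℕ) {K Λ : ℝ} (R : ℝ) (hK : 1 ≤ K) (hΛ : 0 ≤ Λ) :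
    ∃ C : ℝ, 0 ≤ C ∧ ∃ M : ℝ, 0 ≤ M ∧
      ∀ (n : ℕ) (θ : Euc (G.N n)) (p : ℕ → G.X) (κ : ℝ), 0 ≤ κ → M * κ ≤ 1 →
        G.DerivBounds n S θ p K κ → G.CostBounds S p (R + 1) Λ →
        (∀ s ≤ S, ∀ a ≤ S, ‖G.Flin n θ (fun i => p (i + 1)) s (p a)‖ ≤ R) →
        ∀ s ≤ S, ‖G.F n (G.train n θ (fun i => p (i + 1)) s) (p 0) -
          G.Flin n θ (fun i => p (i + 1)) s (p 0)‖ ≤ C * κ ^ 2 := by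
  choose C hC M hM h using fun s => exists_displacement (G := G) S s R hK hΛ
  have hD : ∀ s, 0 ≤ 2 * (S * Λ + K * C s) ^ 2 + 2 * C s := fun s => by
    have := hC s
    positivity
  have hB : ∀ s, 0 ≤ M s + 4 * (S * Λ + K * C s) := fun s => by
    have := hC s
    have := hM s
    positivity
  -- Summing the nonnegative constants of the finitely many steps gives one that is uniform in s.
  refine ⟨∑ s ∈ Finset.range (S + 1), (2 * (S * Λ + K * C s) ^ 2 + 2 * C s),
    Finset.sum_nonneg fun s _ => hD s,
    ∑ s ∈ Finset.range (S + 1), (M s + 4 * (S * Λ + K * C s)),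
    Finset.sum_nonneg fun s _ => hB s, ?_⟩
  intro n θ p κ hκ hMκ hd hc hR s hsS
  have hs : s ∈ Finset.range (S + 1) := by simp; omega
  have h1 := mul_le_mul_of_nonneg_right
    (Finset.single_le_sum (f := fun s => M s + 4 * (S * Λ + K * C s)) (fun s _ => hB s) hs) hκ
  have h2 := mul_le_mul_of_nonneg_right
    (Finset.single_le_sum (f := fun s => 2 * (S * Λ + K * C s) ^ 2 + 2 * C s)
      (fun s _ => hD s) hs) (sq_nonneg κ)
  have h3 : 0 ≤ M s * κ := mul_nonneg (hM s) hκ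
  have h4 : 0 ≤ (S * Λ + K * C s) * κ := by
    have := hC s
    positivity
  obtain ⟨u, b, hub⟩ := h s n θ p κ hκ (by linarith) hsS hd hc hR
  exact (hub.norm_train_sub_Flin_le hd hκ hK (by linarith) hsS (Nat.zero_le S) (Or.inl rfl)).trans
    h2

end GDML

/-! ### Tightness -/

section HighProb

variable {Ω : ℕ → Type*} [∀ n, MeasurableSpace (Ω n)] {P : ∀ n, Measure (Ω n)}

/-- The properties `Q K` hold with probability arbitrarily close to one, for large `K` and
eventually in `n`. -/
def HighProb (P : ∀ n, Measure (Ω n)) (Q : ℝ → ∀ n, Ω n → Prop) : Prop :=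
  ∀ ε : ℝ≥0∞, ε ≠ 0 → ∃ K₀ : ℝ, ∀ K ≥ K₀, ∀ᶠ n in atTop, P n {ω | ¬ Q K n ω} ≤ ε

theorem HighProb.mono {Q Q' : ℝ → ∀ n, Ω n → Prop} (h : HighProb P Q) {K₁ : ℝ}
    (hQ : ∀ K ≥ K₁, ∀ n ω, Q K n ω → Q' K n ω) : HighProb P Q' := by
  intro ε hε
  obtain ⟨K₀, hK₀⟩ := h ε hε
  refine ⟨max K₀ K₁, fun K hK => ?_⟩
  filter_upwards [hK₀ K ((le_max_left _ _).trans hK)] with n hn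
  exact (measure_mono (Set.ofPred_subset_ofPred.2 fun ω hω h' =>
    hω (hQ K ((le_max_right _ _).trans hK) n ω h'))).trans hn

theorem HighProb.and {Q Q' : ℝ → ∀ n, Ω n → Prop} (h : HighProb P Q) (h' : HighProb P Q') :
    HighProb P fun K n ω => Q K n ω ∧ Q' K n ω := by
  intro ε hε
  have hε2 : ε / 2 ≠ 0 := by simpa using hε
  obtain ⟨K₀, hK₀⟩ := h (ε / 2) hε2
  obtain ⟨K₁, hK₁⟩ := h' (ε / 2) hε2
  refine ⟨max K₀ K₁, fun K hK => ?_⟩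
  filter_upwards [hK₀ K ((le_max_left _ _).trans hK), hK₁ K ((le_max_right _ _).trans hK)]
    with n hn hn'
  rw [← ENNReal.add_halves ε]
  refine (measure_mono fun ω hω => ?_).trans ((measure_union_le _ _).trans (add_le_add hn hn'))
  exact not_and_or.1 hω

theorem HighProb.forall_finset {ι : Type*} (s : Finset ι) {Q : ι → ℝ → ∀ n, Ω n → Prop}
    (h : ∀ i ∈ s, HighProb P (Q i)) : HighProb P fun K n ω => ∀ i ∈ s, Q i K n ω := by
  classical
  induction s using Finset.induction_on with
  | empty => exact fun ε _ => ⟨0, fun K _ => by simp⟩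
  | insert i s _ ih =>
    refine ((h i (Finset.mem_insert_self i s)).and
      (ih fun j hj => h j (Finset.mem_insert_of_mem hj))).mono (K₁ := 0) fun K _ n ω hω j hj => ?_
    obtain rfl | hj := Finset.mem_insert.1 hj
    exacts [hω.1, hω.2 j hj]

/-- Bounds with a slowly growing factor are bounds with a constant factor, up to events of small
probability. -/
theorem HighProb.of_forall_isLittleO {f : ℕ → ℝ} (hf : ∀ n, 0 ≤ f n) {Q : ∀ n, ℝ → Ω n → Prop}
    (h : ∀ g : ℕ → ℝ, (∀ n, 0 ≤ g n) → f =o[atTop] g →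
      Tendsto (fun n => P n {ω | ¬ Q n (g n) ω}) atTop (𝓝 0)) :
    HighProb P fun K n ω => Q n (K * f n) ω := by
  classical
  intro ε hε
  by_contra! hcon
  choose K hKk hK using fun k : ℕ => hcon k
  obtain ⟨φ, hφ, hφK⟩ := extraction_forall_of_frequently hK
  let c : ℕ → ℝ := fun n => if hn : ∃ k, φ k = n then K hn.choose else n
  have hcφ : ∀ k, c (φ k) = K k := by
    intro k
    have hk : ∃ k', φ k' = φ k := ⟨k, rfl⟩
    simp only [c, dif_pos hk]
    rw [hφ.injective hk.choose_spec]
  have hc0 : ∀ n, 0 ≤ c n := by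
    intro n
    by_cases hn : ∃ k, φ k = n
    · obtain ⟨k, rfl⟩ := hn
      rw [hcφ]
      exact (Nat.cast_nonneg k).trans (hKk k)
    · simp [c, dif_neg hn]
  have hc : Tendsto c atTop atTop := by
    refine tendsto_atTop.2 fun b => ?_
    obtain ⟨k₀, hk₀⟩ := exists_nat_ge b
    filter_upwards [eventually_ge_atTop (φ k₀)] with n hn
    by_cases hn' : ∃ k, φ k = n
    · obtain ⟨k, rfl⟩ := hn'
      rw [hcφ]
      have : k₀ ≤ k := hφ.le_iff_le.1 hn
      exact hk₀.trans ((Nat.cast_le.2 this).trans (hKk k))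
    · simp only [c, dif_neg hn']
      exact hk₀.trans (Nat.cast_le.2 ((hφ.id_le k₀).trans hn))
  have hfo : f =o[atTop] fun n => c n * f n := by
    refine isLittleO_iff.2 fun δ hδ => ?_
    filter_upwards [hc.eventually_ge_atTop δ⁻¹] with n hn
    rw [norm_mul, Real.norm_of_nonneg (hc0 n), ← mul_assoc]
    refine le_mul_of_one_le_left (norm_nonneg _) ?_
    rw [← mul_inv_cancel₀ hδ.ne']
    gcongr
  have h1 := (h _ (fun n => mul_nonneg (hc0 n) (hf n)) hfo).comp hφ.tendsto_atTop
  have h2 := (ENNReal.tendsto_nhds_zero.1 h1 (ε / 2) (by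
    simpa [pos_iff_ne_zero] using hε)).exists
  obtain ⟨k, hk⟩ := h2
  simp only [Function.comp_apply, hcφ] at hk
  have h3 := (hφK k).trans_le hk
  exact absurd h3 (not_lt.2 ENNReal.half_le_self)

end HighProb

namespace GDML

variable {dX dY : ℕ} (G : GDML dX dY)

/-! ### Exchangeability of the inputs -/

variable {G} in
/-- The inputs of a sample: the test input, followed by the training inputs. -/
def points {n : ℕ} (ω : G.Sample n) : ℕ → G.X
  | 0 => ω.2.1
  | i + 1 => ω.2.2 i

variable {G} in
/-- Permutation of the inputs of a sample. -/
def permute {n : ℕ} (τ : Equiv.Perm ℕ) (ω : G.Sample n) : G.Sample n :=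
  (ω.1, points ω (τ 0), fun i => points ω (τ (i + 1)))

theorem points_permute {n : ℕ} (τ : Equiv.Perm ℕ) (ω : G.Sample n) :
    points (permute τ ω) = points ω ∘ τ := by
  funext i
  cases i <;> rfl

theorem measurePreserving_cons {X : Type*} [MeasurableSpace X] (μ : Measure X)
    [IsProbabilityMeasure μ] :
    MeasurePreserving (fun q : X × (ℕ → X) => (fun i : ℕ => i.casesOn q.1 q.2 : ℕ → X))
      (μ.prod (Measure.infinitePi fun _ : ℕ => μ)) (Measure.infinitePi fun _ : ℕ => μ) := by
  have hm : Measurable (fun q : X × (ℕ → X) => (fun i : ℕ => i.casesOn q.1 q.2 : ℕ → X)) := by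
    refine measurable_pi_lambda _ fun i => ?_
    cases i with
    | zero => exact measurable_fst
    | succ i => exact (measurable_pi_apply i).comp measurable_snd
  refine ⟨hm, Measure.eq_infinitePi _ fun s t ht => ?_⟩
  classical
  rw [Measure.map_apply hm (MeasurableSet.pi s.countable_toSet fun i _ => ht i)]
  let s' : Finset ℕ := s.preimage Nat.succ Nat.succ_injective.injOn
  have h1 : (fun q : X × (ℕ → X) => (fun i : ℕ => i.casesOn q.1 q.2 : ℕ → X)) ⁻¹'
      (Set.pi (s : Set ℕ) t) =
      (if 0 ∈ s then t 0 else Set.univ) ×ˢ Set.pi (s' : Set ℕ) fun i => t (i + 1) := by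
    ext q
    simp only [Set.mem_preimage, Set.mem_pi, Set.mem_prod, Finset.mem_coe, s',
      Finset.mem_preimage]
    constructor
    · intro h
      refine ⟨?_, fun i hi => h (i + 1) hi⟩
      split_ifs with h0
      exacts [h 0 h0, trivial]
    · rintro ⟨h0, h1⟩ i hi
      cases i with
      | zero => simpa [hi] using h0
      | succ i => exact h1 i hi
  rw [h1, Measure.prod_prod, Measure.infinitePi_pi _ fun i _ => ht (i + 1)]
  have h2 : ∏ i ∈ s', μ (t (i + 1)) = ∏ i ∈ s.erase 0, μ (t i) := by
    refine Finset.prod_bij (fun i _ => i + 1) ?_ ?_ ?_ ?_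
    · intro i hi
      simpa [s'] using hi
    · intro i _ j _ h
      simpa using h
    · intro i hi
      obtain ⟨h0, hi⟩ := Finset.mem_erase.1 hi
      obtain ⟨j, rfl⟩ := Nat.exists_eq_succ_of_ne_zero h0
      exact ⟨j, by simpa [s'] using hi, rfl⟩
    · intros; rfl
  rw [h2]
  by_cases h0 : 0 ∈ s
  · rw [if_pos h0, Finset.mul_prod_erase s (fun i => μ (t i)) h0]
  · rw [if_neg h0, measure_univ, one_mul, Finset.erase_eq_of_notMem h0]

theorem measurePreserving_split {X : Type*} [MeasurableSpace X] (μ : Measure X)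
    [IsProbabilityMeasure μ] :
    MeasurePreserving (fun q : ℕ → X => (q 0, fun i => q (i + 1)))
      (Measure.infinitePi fun _ : ℕ => μ) (μ.prod (Measure.infinitePi fun _ : ℕ => μ)) := by
  have hm : Measurable (fun q : ℕ → X => (q 0, fun i => q (i + 1))) := by fun_prop
  refine ⟨hm, ?_⟩
  conv_lhs => rw [← (measurePreserving_cons μ).map_eq]
  rw [Measure.map_map hm (measurePreserving_cons μ).measurable]
  exact Measure.map_id

/-- Prepending the test input to the training path yields a single i.i.d. sequence, whose law is
invariant under permutations. -/
theorem measurePreserving_permute (n : ℕ) (τ : Equiv.Perm ℕ) :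
    MeasurePreserving (permute τ) (G.law n) (G.law n) := by
  have h1 : MeasurePreserving (fun q : ℕ → G.X => fun i => q (τ i))
      (Measure.infinitePi fun _ : ℕ => G.inputLaw) (Measure.infinitePi fun _ : ℕ => G.inputLaw) :=
    ⟨by fun_prop, Measure.map_infinitePi_infinitePi_of_inj (P := fun _ : ℕ => G.inputLaw)
      τ.injective⟩
  have h2 := (measurePreserving_split G.inputLaw).comp (h1.comp (measurePreserving_cons G.inputLaw))
  have h3 : MeasurePreserving _ (G.law n) (G.law n) :=
    (MeasurePreserving.id (G.initLaw n)).prod h2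
  have h4 : ∀ ω : G.Sample n, points ω = fun i : ℕ => i.casesOn ω.2.1 ω.2.2 := by
    intro ω
    funext i
    cases i <;> rfl
  convert h3 using 1
  funext ω
  simp only [permute, h4]
  rfl

instance (n : ℕ) : IsProbabilityMeasure (G.law n) := by
  unfold law
  infer_instance

theorem measurePreserving_test (n : ℕ) :
    MeasurePreserving (fun ω : G.Sample n => ω.2.1) (G.law n) G.inputLaw :=
  measurePreserving_fst.comp measurePreserving_snd

variable {G}

/-- An inequality suffices, and holds for events that need not be measurable. -/
theorem measure_permute_le {n : ℕ} (τ : Equiv.Perm ℕ) (Q : G.Sample n → Prop) :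
    G.law n {ω | ¬ Q (permute τ ω)} ≤ G.law n {ω | ¬ Q ω} :=
  (G.measurePreserving_permute n τ).measure_preimage_le {ω | ¬ Q ω}

theorem _root_.HighProb.permute {Q : ℝ → ∀ n, G.Sample n → Prop} (h : HighProb G.law Q)
    (τ : Equiv.Perm ℕ) : HighProb G.law fun K n ω => Q K n (permute τ ω) := by
  intro ε hε
  obtain ⟨K₀, hK₀⟩ := h ε hε
  refine ⟨K₀, fun K hK => ?_⟩
  filter_upwards [hK₀ K hK] with n hn
  exact (measure_permute_le τ _).trans hn

end GDML

namespace GDML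

variable {dX dY : ℕ} (G : GDML dX dY)

/-! ### Local bounds of the gradient of the cost -/

theorem hasFDerivAt_cost (z y : Euc dY) :
    HasFDerivAt (fun z' => G.cost z' y) (InnerProductSpace.toDual ℝ _ (G.cost' z y)) z :=
  (G.cost_analytic y z (Set.mem_univ z)).differentiableAt.hasGradientAt.hasFDerivAt

/-- Directional derivatives are limits of difference quotients, which are measurable in the label.
-/
theorem measurable_cost' (z : Euc dY) : Measurable (G.cost' z) := by
  have h1 : ∀ v : Euc dY, Measurable fun y => inner ℝ (G.cost' z y) v := by
    intro v
    refine measurable_of_tendsto_metrizable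
      (f := fun (k : ℕ) y => (k : ℝ) • (G.cost (z + (k : ℝ)⁻¹ • v) y - G.cost z y)) (fun k => ?_) ?_
    · have h2 : ∀ w : Euc dY, Measurable fun y => G.cost w y := fun w =>
        G.cost_measurable.comp (measurable_const.prodMk measurable_id)
      simp only [smul_eq_mul]
      exact ((h2 _).sub (h2 _)).const_mul _
    · refine tendsto_pi_nhds.2 fun y => ?_
      have := ((G.hasFDerivAt_cost z y).lim_real v).comp tendsto_natCast_atTop_atTop
      simpa [Function.comp_def] using this
  have h2 : G.cost' z = fun y => ∑ i, inner ℝ (G.cost' z y) (stdOrthonormalBasis ℝ (Euc dY) i) •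
      stdOrthonormalBasis ℝ (Euc dY) i := by
    funext y
    conv_lhs => rw [← (stdOrthonormalBasis ℝ (Euc dY)).sum_repr' (G.cost' z y)]
    simp only [real_inner_comm]
  rw [h2]
  exact Finset.measurable_fun_sum _ fun i _ => (h1 _).smul_const _

theorem contDiff_cost' (y : Euc dY) : ContDiff ℝ 1 fun z => G.cost' z y := by
  have h1 : ContDiff ℝ 2 fun z => G.cost z y :=
    contDiff_iff_contDiffAt.2 fun z => (G.cost_analytic y z (Set.mem_univ z)).contDiffAt
  have h2 : ContDiff ℝ 1 (fderiv ℝ fun z => G.cost z y) := h1.fderiv_right (by norm_num)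
  exact (InnerProductSpace.toDual ℝ (Euc dY)).symm.contDiff.comp h2

/-- The gradient of the cost is bounded by and Lipschitz with constant `Λ` on `A`. -/
def CostBoundedOn (A : Set (Euc dY)) (Λ : ℝ) (y : Euc dY) : Prop :=
  (∀ z ∈ A, ‖G.cost' z y‖ ≤ Λ) ∧
    ∀ z ∈ A, ∀ z' ∈ A, ‖G.cost' z y - G.cost' z' y‖ ≤ Λ * ‖z - z'‖

variable {G}

theorem CostBoundedOn.mono {A : Set (Euc dY)} {Λ Λ' : ℝ} {y : Euc dY}
    (h : G.CostBoundedOn A Λ y) (hΛ : Λ ≤ Λ') : G.CostBoundedOn A Λ' y :=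
  ⟨fun z hz => (h.1 z hz).trans hΛ, fun z hz z' hz' => (h.2 z hz z' hz').trans (by gcongr)⟩

theorem CostBoundedOn.closure {A : Set (Euc dY)} {Λ : ℝ} {y : Euc dY}
    (h : G.CostBoundedOn A Λ y) : G.CostBoundedOn (closure A) Λ y := by
  have hc := (G.contDiff_cost' y).continuous
  constructor
  · intro z hz
    refine closure_minimal (s := A) (t := {z | ‖G.cost' z y‖ ≤ Λ}) h.1 ?_ hz
    exact isClosed_le hc.norm continuous_const
  · intro z hz z' hz'
    have h1 : A ×ˢ A ⊆ {q : Euc dY × Euc dY |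
        ‖G.cost' q.1 y - G.cost' q.2 y‖ ≤ Λ * ‖q.1 - q.2‖} := fun q hq => h.2 _ hq.1 _ hq.2
    have hcl : IsClosed {q : Euc dY × Euc dY |
        ‖G.cost' q.1 y - G.cost' q.2 y‖ ≤ Λ * ‖q.1 - q.2‖} :=
      isClosed_le ((hc.comp continuous_fst).sub (hc.comp continuous_snd)).norm
        (continuous_const.mul (continuous_fst.sub continuous_snd).norm)
    have hm : (z, z') ∈ _root_.closure (A ×ˢ A) := by
      rw [closure_prod_eq]
      exact ⟨hz, hz'⟩
    have h2 := closure_minimal h1 hcl hm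
    rwa [Set.mem_ofPred_eq] at h2

variable (G)

theorem exists_costBoundedOn (R : ℝ) (y : Euc dY) :
    ∃ k : ℕ, G.CostBoundedOn (Metric.closedBall 0 R) k y := by
  have hc := G.contDiff_cost' y
  have hK := isCompact_closedBall (0 : Euc dY) R
  obtain ⟨C, hC⟩ := hK.exists_bound_of_continuousOn hc.continuous.continuousOn
  obtain ⟨L, hL⟩ := (hc.locallyLipschitz.locallyLipschitzOn
    (s := Metric.closedBall 0 R)).exists_lipschitzOnWith_of_compact hK
  obtain ⟨k, hk⟩ := exists_nat_ge (max C L)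
  refine ⟨k, fun z hz => (hC z hz).trans ((le_max_left _ _).trans hk), fun z hz z' hz' => ?_⟩
  have := hL.norm_sub_le hz hz'
  refine this.trans ?_
  gcongr
  exact (le_max_right _ _).trans hk

/-- Every label admits some bound `k`, so the exceptional sets decrease to the empty set and their
measures tend to zero. -/
theorem exists_measure_not_costBoundedOn_le (R : ℝ) {ε : ℝ≥0∞} (hε : ε ≠ 0) :
    ∃ k : ℕ, G.inputLaw {x | ¬ G.CostBoundedOn (Metric.closedBall 0 R) k (G.target x)} ≤ ε := by
  obtain ⟨D, hDc, hD⟩ := TopologicalSpace.exists_countable_dense (Euc dY)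
  -- A countable set makes the events measurable. The larger open ball ensures that its closure
  -- contains the closed ball of radius R.
  let A : Set (Euc dY) := Metric.ball 0 (R + 1) ∩ D
  have hAc : A.Countable := hDc.mono Set.inter_subset_right
  have hA : Metric.closedBall 0 R ⊆ closure A :=
    (Metric.closedBall_subset_ball (by linarith)).trans
      (hD.open_subset_closure_inter Metric.isOpen_ball)
  let B : ℕ → Set G.X := fun k => {x | ¬ G.CostBoundedOn A k (G.target x)}
  have hcm : ∀ z, Measurable fun x => G.cost' z (G.target x) := fun z =>
    (G.measurable_cost' z).comp G.target_measurable
  have hBm : ∀ k, MeasurableSet (B k) := by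
    intro k
    have : MeasurableSet {x | G.CostBoundedOn A k (G.target x)} := by
      simp only [CostBoundedOn, Set.ofPred_and, Set.ofPred_forall]
      refine (MeasurableSet.biInter hAc fun z _ => ?_).inter
        (MeasurableSet.biInter hAc fun z _ => MeasurableSet.biInter hAc fun z' _ => ?_)
      · exact measurableSet_le (hcm z).norm measurable_const
      · exact measurableSet_le ((hcm z).sub (hcm z')).norm measurable_const
    exact this.compl
  have hBa : Antitone B := fun k l hkl x hx h => hx (h.mono (by exact_mod_cast hkl))
  have hBi : ⋂ k, B k = ∅ := by
    refine Set.eq_empty_of_forall_notMem fun x hx => ?_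
    obtain ⟨k, hk⟩ := G.exists_costBoundedOn (R + 1) (G.target x)
    have hAk : A ⊆ Metric.closedBall 0 (R + 1) :=
      Set.inter_subset_left.trans Metric.ball_subset_closedBall
    exact Set.mem_iInter.1 hx k ⟨fun z hz => hk.1 z (hAk hz),
      fun z hz z' hz' => hk.2 z (hAk hz) z' (hAk hz')⟩
  have h1 := tendsto_measure_iInter_atTop (μ := G.inputLaw)
    (fun k => (hBm k).nullMeasurableSet) hBa ⟨0, measure_ne_top _ _⟩
  rw [hBi, measure_empty] at h1
  obtain ⟨k, hk⟩ := (ENNReal.tendsto_nhds_zero.1 h1 ε (pos_iff_ne_zero.2 hε)).exists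
  refine ⟨k, (measure_mono (Set.ofPred_subset_ofPred.2 fun x hx h => hx ?_)).trans hk⟩
  have h2 := CostBoundedOn.closure h
  exact ⟨fun z hz => h2.1 z (hA hz), fun z hz z' hz' => h2.2 z (hA hz) z' (hA hz')⟩

theorem highProb_costBounds (S : ℕ) (R : ℝ) :
    HighProb G.law fun Λ _ ω => G.CostBounds S (points ω) R Λ := by
  have h1 : HighProb G.law fun Λ n (ω : G.Sample n) =>
      G.CostBoundedOn (Metric.closedBall 0 R) Λ (G.target (points ω 0)) := by
    intro ε hε
    obtain ⟨k, hk⟩ := G.exists_measure_not_costBoundedOn_le R hε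
    refine ⟨k, fun Λ hΛ => Eventually.of_forall fun n => ?_⟩
    refine (measure_mono (Set.ofPred_subset_ofPred.2 fun ω hω h => hω (h.mono hΛ))).trans
      (((G.measurePreserving_test n).measure_preimage_le _).trans hk)
  refine (HighProb.forall_finset (Finset.range (S + 1)) fun a _ =>
    h1.permute (Equiv.swap 0 a)).mono (K₁ := 0) fun Λ _ n ω h a ha => ?_
  have := h a (by simp; omega)
  rw [points_permute, Function.comp_apply, Equiv.swap_apply_left] at this
  exact ⟨fun z hz => this.1 z (by simpa using hz),
    fun z z' hz hz' => this.2 z (by simpa using hz) z' (by simpa using hz')⟩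

end GDML

namespace GDML

variable {dX dY : ℕ} {G : GDML dX dY}

/-! ### The deviation from the linearisation -/

/-- The largest eigenvalue in η_cor is the squared norm of the Jacobian, so subcriticality bounds
ηL‖∇F‖² by 2. -/
theorem norm_jac_le_of_lt_criticalRate {n : ℕ} {L : ℝ} (hL : 0 < L) {θ : Euc (G.N n)} {x : G.X}
    (h : ENNReal.ofReal (G.η n) < G.criticalRate n L θ x) :
    ‖G.jac n θ x‖ ≤ √(2 / L) * (1 / √(G.η n)) := by
  have hη := G.η_pos n
  have h1 : ‖G.jac n θ x ∘L G.jacT n θ x‖ = ‖G.jac n θ x‖ ^ 2 := by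
    have := ContinuousLinearMap.norm_adjoint_comp_self (G.jacT n θ x)
    rw [jacT, ContinuousLinearMap.adjoint_adjoint, LinearIsometryEquiv.norm_map] at this
    rw [jacT, this, sq]
  have h2 : G.η n * (L * ‖G.jac n θ x‖ ^ 2) ≤ 2 := by
    by_contra! hcon
    refine absurd h (not_lt.2 ?_)
    rw [criticalRate, h1]
    refine ENNReal.div_le_of_le_mul ?_
    rw [← ENNReal.ofReal_mul hη.le]
    simpa using ENNReal.ofReal_le_ofReal hcon.le
  rw [mul_one_div, ← Real.sqrt_div' _ hη.le]
  refine Real.le_sqrt_of_sq_le ?_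
  rw [le_div_iff₀ hη, le_div_iff₀ hL]
  linarith

theorem Subcritical.stochBigO_deriv_one {L : ℝ} (hL : 0 < L) (h : G.Subcritical L) :
    StochBigO G.law (fun n ω => ‖G.deriv n 1 ω.1 ω.2.1‖) fun n => 1 / √(G.η n) := by
  intro g hg hfg
  refine tendsto_of_tendsto_of_tendsto_of_le_of_le' tendsto_const_nhds h
    (Eventually.of_forall fun n => zero_le) ?_
  have hc : 0 < √(2 / L) := Real.sqrt_pos.2 (by positivity)
  filter_upwards [isLittleO_iff.1 hfg (inv_pos.2 hc)] with n hn
  rw [Real.norm_of_nonneg (hg n), Real.norm_of_nonneg (by positivity), ← div_eq_inv_mul,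
    le_div_iff₀ hc] at hn
  refine measure_mono (Set.ofPred_subset_ofPred.2 fun ω hω h' => hω ?_)
  rw [deriv, norm_iteratedFDeriv_one]
  refine (norm_jac_le_of_lt_criticalRate hL h').trans ?_
  linarith

/-- Subcriticality gives ∇F = O(1/√η), which the domination of higher derivatives extends to all
orders at the test input. Exchangeability moves these bounds and those on correlations to all S + 1
points. -/
theorem highProb_derivBounds {m : ℕ → ℝ} (hG : G.IsPGDML) (hcor : G.ExpWeaklyCorrelated m) {L : ℝ}
    (hL : 0 < L) (hη : G.Subcritical L) (S : ℕ) :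
    HighProb G.law fun K n ω => G.DerivBounds n S ω.1 (points ω) K (K * (1 / √(m n))) := by
  have h1 := HighProb.of_forall_isLittleO (P := G.law) (f := fun n => 1 / √(G.η n))
    (fun n => by positivity)
    (Q := fun n r ω => ∀ d : {d : ℕ // 1 ≤ d}, ‖G.deriv n d ω.1 ω.2.1‖ ≤ r ^ (d : ℕ))
    (hG.deriv_dominated _ (fun n => by positivity) (hη.stochBigO_deriv_one hL))
  have h2 := HighProb.of_forall_isLittleO (P := G.law) (f := fun n => 1 / √(m n))
    (fun n => by positivity)
    (Q := fun n r ω => ∀ i : CorrIndex,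
      ‖G.correlation n i.D i.d ω.1 ω.2.1 (fun k => ω.2.2 (i.mult.index k))‖ ≤ r ^ i.d) hcor
  have h3 := HighProb.forall_finset (Finset.range (S + 1)) fun a _ => h1.permute (Equiv.swap 0 a)
  have h4 := HighProb.forall_finset (Finset.univ : Finset (Equiv.Perm (Finset.range (S + 1))))
    fun τ _ => h2.permute (Equiv.Perm.ofSubtype τ)
  refine (h3.and h4).mono (K₁ := 0) fun K _ n ω hω => ⟨fun j hj k hk => ?_, fun τ i => ?_⟩
  · have := hω.1 j (by simp; omega) ⟨k, hk⟩
    rw [mul_one_div] at this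
    simpa only [permute, Equiv.swap_apply_left] using this
  · exact hω.2 τ (Finset.mem_univ τ) i

theorem Flin_points {n : ℕ} (ω : G.Sample n) (s : ℕ) (a : ℕ) :
    G.Flin n ω.1 (fun i => points ω (i + 1)) (s + 1) (points ω a) =
      G.Flin n ω.1 (fun i => points ω (i + 1)) s (points ω a) -
        G.η n • G.jac n ω.1 (points ω a) (G.jacT n ω.1 (points ω (s + 1))
          (G.cost' (G.Flin n ω.1 (fun i => points ω (i + 1)) s (points ω (s + 1)))
            (G.target (points ω (s + 1))))) :=
  rfl

/-- The linearised hypothesis function stays bounded at the test input and at the training inputs.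
Together with the local bounds of the cost, this makes the gradients of the cost along the
linearised training bounded, for a fixed number of steps. -/
theorem highProb_norm_Flin_le {m : ℕ → ℝ} (hG : G.IsPGDML) (hcor : G.ExpWeaklyCorrelated m)
    {L : ℝ} (hL : 0 < L) (hη : G.Subcritical L) {S s : ℕ} (hs : s ≤ S) :
    HighProb G.law fun R n ω => ∀ a ≤ S,
      ‖G.Flin n ω.1 (fun i => points ω (i + 1)) s (points ω a)‖ ≤ R := by
  induction s with
  | zero =>
    have h1 := HighProb.of_forall_isLittleO (P := G.law) (f := fun _ => 1)
      (fun n => zero_le_one) (Q := fun n r ω => ‖G.F n ω.1 ω.2.1‖ ≤ r) hG.init_bounded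
    refine (HighProb.forall_finset (Finset.range (S + 1)) fun a _ =>
      h1.permute (Equiv.swap 0 a)).mono (K₁ := 0) fun K _ n ω hω a ha => ?_
    have := hω a (by simp; omega)
    simp only [permute, Equiv.swap_apply_left, mul_one] at this
    exact this
  | succ s ih =>
    intro ε hε
    have hε3 : ε / 3 ≠ 0 := ENNReal.div_ne_zero.2 ⟨hε, by simp⟩
    obtain ⟨R, hR⟩ := ih (by omega) (ε / 3) hε3
    obtain ⟨K₀, hK⟩ := highProb_derivBounds hG hcor hL hη S (ε / 3) hε3
    -- The cost bound is chosen after the radius reached at step s, so the radius may grow with each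
    -- of the finitely many steps.
    obtain ⟨Λ₀, hΛ⟩ := G.highProb_costBounds S R (ε / 3) hε3
    refine ⟨R + (max K₀ 0) ^ 2 * max Λ₀ 0, fun R' hR' => ?_⟩
    filter_upwards [hR R le_rfl, hK _ (le_max_left K₀ 0), hΛ _ (le_max_left Λ₀ 0)] with n h1 h2 h3
    rw [← ENNReal.add_thirds ε]
    refine (measure_mono ?_).trans ((measure_union_le _ _).trans
      (add_le_add ((measure_union_le _ _).trans (add_le_add h1 h2)) h3))
    intro ω hω
    by_contra hcon
    simp only [Set.mem_union, Set.mem_ofPred_eq, not_or, not_not] at hcon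
    obtain ⟨⟨hF, hD⟩, hC⟩ := hcon
    refine hω fun a ha => ?_
    rw [Flin_points]
    have h4 := (hC (s + 1) hs).1 _ (hF (s + 1) hs)
    have h5 := hD.norm_smul_jac_jacT_le (le_max_right K₀ 0) ha hs
      (G.cost' (G.Flin n ω.1 (fun i => points ω (i + 1)) s (points ω (s + 1)))
        (G.target (points ω (s + 1))))
    refine (norm_sub_le_of_le (hF a ha) h5).trans (le_trans ?_ hR')
    gcongr

end GDML

theorem mainTheorem4 {dX dY : ℕ} (G : GDML dX dY) (m : ℕ → ℝ) (hm : Tendsto m atTop atTop)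
    (hG : G.IsPGDML) (hcor : G.ExpWeaklyCorrelated m)
    (L : ℝ) (hL : 0 < L) (hη : G.Subcritical L)
    (S : ℕ) (T : ℝ) (hT : 0 < T)
    (hC' : StochBigOUnif G.law
      (fun n (s : Set.Icc 1 S) ω =>
        ‖G.cost' (G.Flin n ω.1 ω.2.2 s ω.2.1) (G.target ω.2.1)‖)
      (fun s r => Real.exp (-((s : ℕ) : ℝ) / T) * r) (fun _ => 1))
    (hC'' : StochBigOUnif G.law
      (fun n (s : Set.Icc 1 S) ω =>
        ‖G.cost'' (G.Flin n ω.1 ω.2.2 s ω.2.1) (G.target ω.2.1)‖)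
      (fun _ r => r) (fun _ => 1)) :
    StochBigOUnif G.law
      (fun n (s : Set.Icc 1 S) ω =>
        ‖G.F n (G.train n ω.1 ω.2.2 s) ω.2.1 - G.Flin n ω.1 ω.2.2 s ω.2.1‖)
      (fun s r => ((s : ℕ) : ℝ) ^ 0 * r) (fun n => 1 / m n) := by
  intro g hg hmg
  refine ENNReal.tendsto_nhds_zero.2 fun ε hε => ?_
  have hε3 : ε / 3 ≠ 0 := ENNReal.div_ne_zero.2 ⟨hε.ne', by simp⟩
  obtain ⟨K₀, hK₀⟩ := GDML.highProb_derivBounds hG hcor hL hη S (ε / 3) hε3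
  obtain ⟨R, hR⟩ := HighProb.forall_finset (Finset.range (S + 1)) (fun s hs =>
    GDML.highProb_norm_Flin_le hG hcor hL hη (S := S) (s := s) (by simp at hs; omega)) (ε / 3) hε3
  obtain ⟨Λ₀, hΛ₀⟩ := G.highProb_costBounds S (R + 1) (ε / 3) hε3
  set K := max K₀ 1 with hKdef
  -- All constants depend only on ε and the fixed data, not on n, so both κ → 0 and 1/m = o(g) can
  -- be used afterwards.
  obtain ⟨C, hC, M, hM, hdev⟩ := GDML.exists_norm_train_sub_Flin_le (G := G) S R
    (le_max_right K₀ 1) (le_max_right Λ₀ 0)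
  have hκ : Tendsto (fun n => M * (K * (1 / √(m n)))) atTop (𝓝 0) := by
    have h1 : Tendsto (fun n => 1 / √(m n)) atTop (𝓝 0) := by
      simp only [one_div]
      exact (Real.tendsto_sqrt_atTop.comp hm).inv_tendsto_atTop
    simpa using (h1.const_mul K).const_mul M
  have hK0 : 0 < K := lt_of_lt_of_le one_pos (le_max_right K₀ 1)
  filter_upwards [hK₀ K (le_max_left _ _), hR R le_rfl, hΛ₀ _ (le_max_left Λ₀ 0),
    hκ.eventually (eventually_le_nhds one_pos), hm.eventually_gt_atTop 0,
    -- The deviation is at most Cκ² = CK²/m; the added 1 keeps the inverse positive when C = 0.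
    isLittleO_iff.1 hmg (show 0 < (C * K ^ 2 + 1)⁻¹ by positivity)] with n h1 h2 h3 h4 h5 h6
  rw [← ENNReal.add_thirds ε]
  refine (measure_mono ?_).trans ((measure_union_le _ _).trans
    (add_le_add ((measure_union_le _ _).trans (add_le_add h1 h2)) h3))
  intro ω hω
  by_contra hcon
  simp only [Set.mem_union, Set.mem_ofPred_eq, not_or, not_not] at hcon
  obtain ⟨⟨hD, hF⟩, hc⟩ := hcon
  refine hω fun s => ?_
  rw [pow_zero, one_mul]
  refine (hdev n ω.1 (GDML.points ω) _ (by positivity) h4 hD hc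
    (fun s hs a ha => hF s (by simp; omega) a ha) s s.2.2).trans ?_
  rw [Real.norm_of_nonneg (hg n), Real.norm_of_nonneg (by positivity), ← div_eq_inv_mul,
    le_div_iff₀ (by positivity)] at h6
  have h7 : C * (K * (1 / √(m n))) ^ 2 = 1 / m n * (C * K ^ 2) := by
    rw [mul_pow, div_pow, one_pow, Real.sq_sqrt h5.le]
    ring
  rw [h7]
  refine le_trans ?_ h6
  gcongr
  linarith
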